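/- **Theorem 1 (Rademacher's formula).** Let $p(n)$ denote the number of partitions of $n$. For every positive integer $n$, $$p(n)=\frac{1}{\pi\sqrt2}\sum_{c=1}^{\infty}A_c(n)\,\sqrt c\;\frac{d}{dn}\left[\frac{\sinh\!\big(\mu\sqrt{n-1/24}\,/c\big)}{\sqrt{n-1/24}}\right],$$ where the series converges absolutely, $\mu=\pi\sqrt{2/3}$, the derivative is that of the displayed function of a real variable, taken at the integer $n$, and the coefficients are $$A_c(n)=e^{\pi i/4}\,A\!\left(-\tfrac1{24},\,n-\tfrac1{24};\,c\right).$$ Here, for $m\in\frac1{24}\mathbb Z$, $\nu\in m+\mathbb Z$ and an integer $c\ge1$, $A(m,\nu;c)$ is the generalized Kloosterman sum $$A(m,\nu;c)=\sum_{\substack{d\ (\mathrm{mod}\ c)\\ \gcd(c,d)=1}} v_\eta(M)^{-24m}\,e^{2\pi i\frac{ma+\nu d}{c}},\qquad M=\begin{pmatrix}a&*\\ c&d\end{pmatrix}\in SL_2(\mathbb Z),$$ whose summands do not depend on the choice of $M$ and of the representative $d$. The eta multiplier $v_\eta$ is defined by $$\eta(M\tau)=v_\eta(M)\sqrt{c\tau+d}\;\eta(\tau)\qquad\text{for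 all }\tau\in\mathbb H,\ M=\begin{pmatrix}*&*\\ c&d\end{pmatrix}\in SL_2(\mathbb Z),$$ where $\eta(\tau)=e^{2\pi i\tau/24}\prod_{k\ge1}(1-e^{2\pi i k\tau})$ is the Dedekind eta function and the square root is taken with $-\pi\le\arg z<\pi$. -/

import Mathlib

open scoped MatrixGroups UpperHalfPlane

noncomputable section

namespace Rademacher

/-- The square root of a complex number `z`, extracted with the convention `-π ≤ arg z < π`.
It differs from the principal power `z ^ (1/2)` (for which `-π < arg z ≤ π`) exactly on the
negative real axis, and there by a sign. -/
def csqrt (z : ℂ) : ℂ :=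
  if z.arg = Real.pi then -(z ^ (1 / 2 : ℂ)) else z ^ (1 / 2 : ℂ)

theorem csqrt_sq (z : ℂ) : csqrt z ^ 2 = z := by
  have h : (z ^ (1 / 2 : ℂ)) ^ 2 = z := by
    simp
  unfold csqrt
  split_ifs
  · rw [neg_sq, h]
  · exact h

theorem csqrt_ne_zero {z : ℂ} (hz : z ≠ 0) : csqrt z ≠ 0 := fun h => hz <| by
  rw [← csqrt_sq z, h]; simp

theorem continuousAt_csqrt {z : ℂ} (hz : z ∈ Complex.slitPlane) : ContinuousAt csqrt z := by
  have h1 : ContinuousAt (fun w : ℂ => w ^ (1 / 2 : ℂ)) z :=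
    continuousAt_id.cpow continuousAt_const hz
  refine h1.congr ?_
  filter_upwards [Complex.isOpen_slitPlane.mem_nhds hz] with w hw
  simp [csqrt, (Complex.mem_slitPlane_iff_arg.mp hw).1]

theorem eta_smul_pow (M : SL(2, ℤ)) (τ : ℍ) :
    ModularForm.eta ((M • τ : ℍ) : ℂ) ^ 24
      = ((M 1 0 : ℂ) * (τ : ℂ) + (M 1 1 : ℂ)) ^ 12 * ModularForm.eta (τ : ℂ) ^ 24 := by
  have h := congrFun (SlashInvariantForm.slash_action_generators_SL2Z
    ModularForm.discriminant_S_invariant ModularForm.discriminant_T_invariant M) τ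
  rw [ModularForm.SL_slash_apply] at h
  have hd := UpperHalfPlane.denom_ne_zero (M : GL (Fin 2) ℝ) τ
  have h2 : ModularForm.discriminant (M • τ)
      = UpperHalfPlane.denom (M : GL (Fin 2) ℝ) τ ^ 12 * ModularForm.discriminant τ := by
    rw [← h, zpow_neg, mul_comm (ModularForm.discriminant _)]
    exact (mul_inv_cancel_left₀ (pow_ne_zero 12 hd) _).symm
  simpa [ModularForm.discriminant, UpperHalfPlane.denom] using h2

/-- For every `M = [* *; c d]` in the modular group there is a unique constant `v`
such that `η(Mτ) = v √(cτ + d) η(τ)` on the upper half plane. -/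
theorem existsUnique_etaMultiplier (M : SL(2, ℤ)) :
    ∃! v : ℂ, ∀ τ : ℍ, ModularForm.eta ((M • τ : ℍ) : ℂ)
      = v * csqrt ((M 1 0 : ℂ) * (τ : ℂ) + (M 1 1 : ℂ)) * ModularForm.eta (τ : ℂ) := by
  have hη : ∀ τ : ℍ, ModularForm.eta (τ : ℂ) ≠ 0 := fun τ => ModularForm.eta_ne_zero τ.2
  have hηc : Continuous fun τ : ℍ => ModularForm.eta (τ : ℂ) :=
    continuous_iff_continuousAt.mpr fun τ =>
      (ModularForm.differentiableAt_eta_of_mem_upperHalfPlaneSet τ.2).continuousAt.comp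
        UpperHalfPlane.continuous_coe.continuousAt
  have hd : ∀ τ : ℍ, (M 1 0 : ℂ) * (τ : ℂ) + (M 1 1 : ℂ) ≠ 0 := fun τ => by
    have := UpperHalfPlane.denom_ne_zero (M : GL (Fin 2) ℝ) τ
    simpa [UpperHalfPlane.denom] using this
  have hs : ∀ τ : ℍ, csqrt ((M 1 0 : ℂ) * (τ : ℂ) + (M 1 1 : ℂ)) ≠ 0 :=
    fun τ => csqrt_ne_zero (hd τ)
  have hsc : Continuous fun τ : ℍ => csqrt ((M 1 0 : ℂ) * (τ : ℂ) + (M 1 1 : ℂ)) := by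
    by_cases hc : M 1 0 = 0
    · simpa [hc] using continuous_const
    · refine continuous_iff_continuousAt.mpr fun τ => ?_
      have hm : (M 1 0 : ℂ) * (τ : ℂ) + (M 1 1 : ℂ) ∈ Complex.slitPlane := by
        refine Or.inr ?_
        simpa using ⟨hc, τ.im_ne_zero⟩
      have h2 : ContinuousAt (fun τ : ℍ => (M 1 0 : ℂ) * (τ : ℂ) + (M 1 1 : ℂ)) τ := by
        fun_prop
      exact ContinuousAt.comp (f := fun τ : ℍ => (M 1 0 : ℂ) * (τ : ℂ) + (M 1 1 : ℂ))
        (continuousAt_csqrt hm) h2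
  let f : ℍ → ℂ := fun τ => ModularForm.eta ((M • τ : ℍ) : ℂ) /
    (csqrt ((M 1 0 : ℂ) * (τ : ℂ) + (M 1 1 : ℂ)) * ModularForm.eta (τ : ℂ))
  have hf : Continuous f :=
    (hηc.comp (continuous_const_smul (M : GL (Fin 2) ℝ))).div (hsc.mul hηc) fun τ => mul_ne_zero (hs τ) (hη τ)
  have hf1 : ∀ τ, f τ ^ 24 = 1 := fun τ => by
    have h24 : csqrt ((M 1 0 : ℂ) * (τ : ℂ) + (M 1 1 : ℂ)) ^ 24
        = ((M 1 0 : ℂ) * (τ : ℂ) + (M 1 1 : ℂ)) ^ 12 := by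
      rw [show 24 = 2 * 12 from rfl, pow_mul, csqrt_sq]
    simp only [f]
    rw [div_pow, mul_pow, eta_smul_pow, h24]
    exact div_self (mul_ne_zero (pow_ne_zero _ (hd τ)) (pow_ne_zero _ (hη τ)))
  have hfin : {z : ℂ | z ^ 24 = 1}.Finite := by
    refine (Polynomial.nthRoots 24 (1 : ℂ)).toFinset.finite_toSet.subset fun z hz => ?_
    simpa [Polynomial.mem_nthRoots] using hz
  have hconst : ∀ τ, f τ = f UpperHalfPlane.I := fun τ =>
    isPreconnected_univ.constant_of_mapsTo hfin.isDiscrete hf.continuousOn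
      (fun τ _ => hf1 τ) (Set.mem_univ _) (Set.mem_univ _)
  refine ⟨f UpperHalfPlane.I, fun τ => ?_, fun v hv => ?_⟩
  · rw [← hconst τ, mul_assoc]
    exact (div_mul_cancel₀ _ (mul_ne_zero (hs τ) (hη τ))).symm
  · rw [eq_div_iff (mul_ne_zero (hs _) (hη _)), hv UpperHalfPlane.I, mul_assoc]

/-- The eta multiplier `v_η`: the constant in
`η(Mτ) = v_η(M) √(cτ + d) η(τ)`, for `M = [* *; c d]` in the modular group. -/
def etaMultiplier (M : SL(2, ℤ)) : ℂ := (existsUnique_etaMultiplier M).choose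

/-- A matrix `[a *; c d]` in the modular group with the bottom row `c d`, for coprime `c`, `d`
(and the identity matrix as a default value if `c`, `d` are not coprime). -/
def matrixOfBottomRow (c d : ℤ) : SL(2, ℤ) :=
  if h : Int.gcd d c = 1 then
    ⟨!![Int.gcdA d c, -Int.gcdB d c; c, d], by
      have := Int.gcd_eq_gcd_ab d c
      rw [h] at this
      rw [Matrix.det_fin_two_of]
      push_cast at this
      linarith⟩
  else 1

/-- The generalized Kloosterman sum
`A(m, n; c) = ∑ v_η(M) ^ (-24 m) e ^ (2 π i (m a + n d) / c)`, where `d` runs over the residues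
modulo `c` that are coprime to `c` and `M = [a *; c d]` is in the modular group.
The sum is used for `24 m ∈ ℤ` and `n - m ∈ ℤ`; then the exponent `-24 m` is an integer, and the
summands do not depend on the choice of `M` and of the representative `d`. -/
def kloostermanSum (m n : ℚ) (c : ℕ) : ℂ :=
  ∑ d ∈ (Finset.range c).filter (fun d => Nat.Coprime c d),
    etaMultiplier (matrixOfBottomRow c d) ^ (-24 * (m : ℂ)) *
      Complex.exp (2 * Real.pi * Complex.I *
        (((m : ℂ) * (matrixOfBottomRow c d 0 0 : ℂ) + (n : ℂ) * (d : ℂ)) / (c : ℂ)))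

/-- `A_c(n) = e ^ (π i / 4) A(-1/24, n - 1/24; c)`. -/
def A (c n : ℕ) : ℂ :=
  Complex.exp (Real.pi * Complex.I / 4) * kloostermanSum (-1 / 24) ((n : ℚ) - 1 / 24) c

/-- The constant `μ = π √(2/3)`. -/
def mu : ℝ := Real.pi * Real.sqrt (2 / 3)

/-- The partition function: the number of ways to write `n` as an unordered sum of positive
integers. -/
def p (n : ℕ) : ℕ := Fintype.card (Nat.Partition n)

end Rademacher

end

open scoped MatrixGroups UpperHalfPlane

noncomputable section

namespace Rademacher

section

open Complex Filter Topology Finset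
open scoped PowerSeries.WithPiTopology

/-! ### The generating function of the partition numbers -/

/-! This is the circle method with Rademacher's exact treatment of the main terms. Write P for
Euler's product. Cauchy's formula gives p(n) as the integral of e^(-2πinτ) P(e^(2πiτ)) over a
horizontal segment of length 1 at height 1/N² (`integral_integrand`). As P = q^(1/24)/η, a matrix
with bottom row (k, d) describes the integrand near the cusp -d/k. In the coordinate w with τ = -d/k
+ i/(k²w), it is an elementary function of w times P at a point of modulus e^(-2π Re w)
(`integrand_cusp`), and P(q) = 1 + O(q).

Farey dissection of order N cuts the segment into arcs from cusps to adjacent mediants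
(`integral_eq_sum_arcs`). There Re w ≥ 1/2, and replacing P by 1 costs O(N^(-1/2)) pointwise, hence
O(N^(-3/2)/k) per arc. Up to a factor of modulus k^(-5/2), what remains is the integral of w^(-5/2)
e^(πw/12 + β/w) dw with β = 2π(n - 1/24)/k². A primitive of this kernel on the right half plane has
limits upwards and downwards, and the mediants lie so far out (|Im w| ≥ N/(5k)) that passing to the
limit again costs only O(N^(-3/2)/k). A right and a left arc then complete each other to the line Re
w = 1, and the coefficients sum to A_k(n). There are φ(k) ≤ k pairs of arcs for each k ≤ N, so the
total error is O(N^(-1/2)) (`exists_partial_sum_bound`).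

The line integral is computed by expanding e^(β/w) and inverting Laplace transforms term by term.
The result is the power series of the derivative of the sinh quotient (`lineIntegral_eq_deriv`).
Absolute convergence follows from |A_k(n)| ≤ k and a bound for the line integrals that is uniform in
k. -/

/-- The formal power series `A` converges absolutely at `q`, with sum `v`. -/
def ConvergesAt (A : PowerSeries ℂ) (q v : ℂ) : Prop :=
  Summable (fun m => ‖A.coeff m * q ^ m‖) ∧ HasSum (fun m => A.coeff m * q ^ m) v

theorem ConvergesAt.one (q : ℂ) : ConvergesAt 1 q 1 := by
  have h : ∀ m ≠ 0, (1 : PowerSeries ℂ).coeff m * q ^ m = 0 := fun m hm => by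
    simp [PowerSeries.coeff_one, hm]
  refine ⟨summable_of_ne_finset_zero (s := {0}) fun m hm => ?_, ?_⟩
  · rw [h m (by simpa using hm), norm_zero]
  · simpa using hasSum_single 0 h

theorem ConvergesAt.mul {A B : PowerSeries ℂ} {q v w : ℂ} (hA : ConvergesAt A q v)
    (hB : ConvergesAt B q w) : ConvergesAt (A * B) q (v * w) := by
  have key : ∀ m, ∑ kl ∈ antidiagonal m,
      A.coeff kl.1 * q ^ kl.1 * (B.coeff kl.2 * q ^ kl.2) = (A * B).coeff m * q ^ m := fun m => by
    rw [PowerSeries.coeff_mul, Finset.sum_mul]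
    refine Finset.sum_congr rfl fun kl hkl => ?_
    rw [← mem_antidiagonal.mp hkl, pow_add]
    ring
  have h1 := summable_norm_sum_mul_antidiagonal_of_summable_norm hA.1 hB.1
  have h2 := tsum_mul_tsum_eq_tsum_sum_antidiagonal_of_summable_norm hA.1 hB.1
  simp only [key] at h1 h2
  refine ⟨h1, ?_⟩
  rw [hA.2.tsum_eq, hB.2.tsum_eq] at h2
  rw [h2]
  exact h1.of_norm.hasSum

theorem ConvergesAt.prod {ι : Type*} (s : Finset ι) {A : ι → PowerSeries ℂ} {q : ℂ} {v : ι → ℂ}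
    (h : ∀ i ∈ s, ConvergesAt (A i) q (v i)) : ConvergesAt (∏ i ∈ s, A i) q (∏ i ∈ s, v i) := by
  classical
  induction s using Finset.induction_on with
  | empty => simpa using ConvergesAt.one q
  | insert i s his ih =>
    rw [prod_insert his, prod_insert his]
    exact (h i (mem_insert_self _ _)).mul (ih fun j hj => h j (mem_insert_of_mem hj))

theorem coeff_tsum_X_pow (k m : ℕ) :
    (∑' j : ℕ, (PowerSeries.X : PowerSeries ℂ) ^ ((k + 1) * j)).coeff m
      = if (k + 1) ∣ m then 1 else 0 := by
  have hs : Summable fun j : ℕ => (PowerSeries.X : PowerSeries ℂ) ^ ((k + 1) * j) := by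
    simp_rw [pow_mul]
    exact PowerSeries.WithPiTopology.summable_pow_of_constantCoeff_eq_zero (by simp)
  rw [hs.map_tsum (PowerSeries.coeff m) (PowerSeries.WithPiTopology.continuous_coeff ℂ m)]
  simp only [PowerSeries.coeff_X_pow]
  split_ifs with h
  · obtain ⟨j, rfl⟩ := h
    rw [tsum_eq_single j]
    · simp
    · intro i hi
      simp [Ne.symm hi]
  · rw [tsum_congr (β := ℕ) (g := fun _ => (0 : ℂ)), tsum_zero]
    intro j
    rw [if_neg]
    rintro rfl
    exact h ⟨j, rfl⟩

theorem convergesAt_geometric (k : ℕ) {q : ℂ} (hq : ‖q‖ < 1) :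
    ConvergesAt (∑' j : ℕ, (PowerSeries.X : PowerSeries ℂ) ^ ((k + 1) * j)) q
      (1 - q ^ (k + 1))⁻¹ := by
  have hq' : ‖q ^ (k + 1)‖ < 1 := by
    rw [norm_pow]; exact pow_lt_one₀ (norm_nonneg _) hq (by simp)
  have hsum : Summable fun m => ‖(∑' j : ℕ, (PowerSeries.X : PowerSeries ℂ) ^ ((k + 1) * j)).coeff m
      * q ^ m‖ := by
    refine Summable.of_nonneg_of_le (fun _ => norm_nonneg _) (fun m => ?_)
      (summable_geometric_of_lt_one (norm_nonneg q) hq)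
    rw [coeff_tsum_X_pow, norm_mul, norm_pow]
    split_ifs <;> simp
  refine ⟨hsum, ?_⟩
  have hinj : Function.Injective fun j : ℕ => (k + 1) * j := fun i j h => by simpa using h
  rw [← hinj.hasSum_iff]
  · have h : ((fun m => (∑' j : ℕ, (PowerSeries.X : PowerSeries ℂ) ^ ((k + 1) * j)).coeff m * q ^ m) ∘
        fun j : ℕ => (k + 1) * j) = fun j => (q ^ (k + 1)) ^ j := by
      funext j
      rw [Function.comp_apply, coeff_tsum_X_pow, if_pos (Dvd.intro _ rfl), one_mul, pow_mul]
    rw [h]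
    exact hasSum_geometric_of_norm_lt_one hq'
  · intro m hm
    rw [coeff_tsum_X_pow, if_neg, zero_mul]
    rintro ⟨j, rfl⟩
    exact hm ⟨j, rfl⟩

/-- All but K factors of the formal product are 1, so only a finite product of geometric series has
to be evaluated at q. Infinite products are reached later by letting K grow. -/
theorem convergesAt_restricted (K : ℕ) {q : ℂ} (hq : ‖q‖ < 1) :
    ConvergesAt (PowerSeries.mk fun n => (#(Nat.Partition.restricted n (· ≤ K)) : ℂ)) q
      (∏ i ∈ range K, (1 - q ^ (i + 1)))⁻¹ := by
  have h := Nat.Partition.hasProd_powerSeriesMk_card_restricted ℂ (· ≤ K)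
  have h' := hasProd_prod_of_ne_finset_one (L := .unconditional ℕ) (s := range K) (f := fun i => if i + 1 ≤ K then
    ∑' j : ℕ, (PowerSeries.X : PowerSeries ℂ) ^ ((i + 1) * j) else 1) fun i hi => by
      rw [if_neg]; simpa using hi
  rw [h.unique h', ← prod_inv_distrib]
  refine ConvergesAt.prod _ fun i hi => ?_
  rw [if_pos (by simpa using hi)]
  exact convergesAt_geometric i hq

theorem card_restricted_le (n K : ℕ) : #(Nat.Partition.restricted n (· ≤ K)) ≤ p n :=
  card_le_univ _

theorem card_restricted_of_le {n K : ℕ} (h : n ≤ K) :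
    #(Nat.Partition.restricted n (· ≤ K)) = p n := by
  rw [p, ← card_univ, Nat.Partition.restricted, filter_true_of_mem]
  exact fun x _ i hi => (Nat.Partition.le_of_mem_parts hi).trans h

/-- Euler's product `∏ (1 - q ^ k)⁻¹`, the generating function of the partition numbers. -/
def partGen (q : ℂ) : ℂ := (∏' k : ℕ, (1 - q ^ (k + 1)))⁻¹

theorem tprod_one_sub_pow_ne_zero {q : ℂ} (hq : ‖q‖ < 1) : ∏' k : ℕ, (1 - q ^ (k + 1)) ≠ 0 := by
  refine tprod_one_add_ne_zero_of_summable (f := fun k : ℕ => -q ^ (k + 1)) (fun k h => ?_) ?_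
  · have h1 : q ^ (k + 1) = 1 := by
      simp only [← sub_eq_add_neg] at h
      exact (sub_eq_zero.mp h).symm
    have h2 : ‖q ^ (k + 1)‖ < 1 := by
      rw [norm_pow]; exact pow_lt_one₀ (norm_nonneg _) hq (by simp)
    rw [h1, norm_one] at h2
    exact lt_irrefl _ h2
  · simpa using (summable_nat_add_iff 1).mpr (summable_geometric_of_lt_one (norm_nonneg _) hq)

theorem tendsto_finite_product {q : ℂ} (hq : ‖q‖ < 1) :
    Tendsto (fun K => (∏ i ∈ range K, (1 - q ^ (i + 1)))⁻¹) atTop (𝓝 (partGen q)) :=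
  (ModularForm.multipliable_one_sub_pow hq).hasProd.tendsto_prod_nat.inv₀
    (tprod_one_sub_pow_ne_zero hq)

/-- For m < M every partition of m has parts at most M, so the M-th partial sum is at most the M-th
finite product. These products converge, hence are bounded. -/
theorem summable_partition {r : ℝ} (hr0 : 0 ≤ r) (hr : r < 1) :
    Summable fun m => (p m : ℝ) * r ^ m := by
  have hq : ‖(r : ℂ)‖ < 1 := by simpa [abs_of_nonneg hr0] using hr
  obtain ⟨C, hC⟩ := (tendsto_finite_product hq).norm.bddAbove_range
  refine summable_of_sum_range_le (c := C) (fun m => by positivity) fun M => ?_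
  refine le_trans ?_ (hC ⟨M, rfl⟩)
  obtain ⟨h1, h2⟩ := convergesAt_restricted M hq
  have h3 : ∑ m ∈ range M, (p m : ℝ) * r ^ m = ∑ m ∈ range M,
      (#(Nat.Partition.restricted m (· ≤ M)) : ℝ) * r ^ m :=
    sum_congr rfl fun m hm => by rw [card_restricted_of_le (mem_range.mp hm).le]
  have h4 : HasSum (fun m => (#(Nat.Partition.restricted m (· ≤ M)) : ℝ) * r ^ m)
      (∏ i ∈ range M, (1 - r ^ (i + 1)))⁻¹ := by
    rw [← hasSum_ofReal]
    push_cast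
    simpa using h2
  rw [h3]
  refine (sum_le_hasSum _ (fun m _ => by positivity) h4).trans ?_
  refine (le_abs_self _).trans (le_of_eq ?_)
  rw [← Real.norm_eq_abs, ← norm_real]
  push_cast
  rfl

theorem summable_norm_partition {q : ℂ} (hq : ‖q‖ < 1) :
    Summable fun m => ‖(p m : ℂ) * q ^ m‖ := by
  simpa using summable_partition (norm_nonneg q) hq

/-- Dominated convergence as K → ∞: the restricted counts are bounded by p(m) and equal to it once K
≥ m. -/
theorem hasSum_partGen {q : ℂ} (hq : ‖q‖ < 1) :
    HasSum (fun m => (p m : ℂ) * q ^ m) (partGen q) := by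
  have hs := summable_norm_partition hq
  have h : Tendsto (fun K => ∑' m, (#(Nat.Partition.restricted m (· ≤ K)) : ℂ) * q ^ m) atTop
      (𝓝 (∑' m, (p m : ℂ) * q ^ m)) := by
    refine tendsto_tsum_of_dominated_convergence hs (fun m => ?_) (.of_forall fun K m => ?_)
    · refine tendsto_const_nhds.congr' ?_
      filter_upwards [eventually_ge_atTop m] with K hK
      rw [card_restricted_of_le hK]
    · rw [norm_mul, norm_mul]
      gcongr
      simpa using card_restricted_le m K
  have h' : ∀ K, ∑' m, (#(Nat.Partition.restricted m (· ≤ K)) : ℂ) * q ^ m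
      = (∏ i ∈ range K, (1 - q ^ (i + 1)))⁻¹ := fun K => by
    simpa using (convergesAt_restricted K hq).2.tsum_eq
  simp only [h'] at h
  rw [tendsto_nhds_unique (tendsto_finite_product hq) h]
  exact hs.of_norm.hasSum

theorem continuousOn_partGen : ContinuousOn partGen (Metric.ball 0 1) :=
  ModularForm.differentiableOn_tprod_one_sub_pow.continuousOn.inv₀ fun _ hq =>
    tprod_one_sub_pow_ne_zero (by simpa using hq)

/-- On discs of radius less than `1`, Euler's product is `1 + O(q)`. -/
theorem exists_norm_partGen_sub_one_le {r : ℝ} (hr0 : 0 ≤ r) (hr : r < 1) :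
    ∃ C, 0 ≤ C ∧ ∀ q : ℂ, ‖q‖ ≤ r → ‖partGen q - 1‖ ≤ C * ‖q‖ := by
  have hs : Summable fun m => (p (m + 1) : ℝ) * r ^ m := by
    rcases hr0.eq_or_lt with rfl | hr0
    · exact summable_of_ne_finset_zero (s := {0}) fun m hm => by simp_all
    · have := ((summable_nat_add_iff 1).mpr (summable_partition hr0.le hr)).mul_right r⁻¹
      refine this.congr fun m => ?_
      rw [pow_succ]
      field_simp
  refine ⟨∑' m, (p (m + 1) : ℝ) * r ^ m, tsum_nonneg fun m => by positivity, fun q hq => ?_⟩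
  have hq1 : ‖q‖ < 1 := hq.trans_lt hr
  have h0 : (p 0 : ℂ) = 1 := by simp [p]
  have h1 := (hasSum_nat_add_iff' 1).mpr (hasSum_partGen hq1)
  simp only [sum_range_one, h0, pow_zero, mul_one] at h1
  have h2 := (hs.mul_right ‖q‖).hasSum
  rw [tsum_mul_right] at h2
  refine h1.norm_le_of_bounded h2 fun m => ?_
  rw [norm_mul, norm_pow, pow_succ, norm_natCast, ← mul_assoc]
  gcongr

/-! ### The partition numbers as integrals over a horizontal segment -/

/-- The function `e ^ (-2 π i n τ) ∏ (1 - e ^ (2 π i k τ))⁻¹`. -/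
def integrand (n : ℕ) (τ : ℂ) : ℂ :=
  exp (-(2 * Real.pi * I * n * τ)) * partGen (exp (2 * Real.pi * I * τ))

theorem integrand_add_one (n : ℕ) (τ : ℂ) : integrand n (τ + 1) = integrand n τ := by
  have h : exp (2 * Real.pi * I * (τ + 1)) = exp (2 * Real.pi * I * τ) := by
    rw [mul_add, mul_one, exp_periodic]
  have h' : exp (-(2 * Real.pi * I * n * (τ + 1))) = exp (-(2 * Real.pi * I * n * τ)) := by
    rw [show -(2 * Real.pi * I * n * (τ + 1)) = -(2 * Real.pi * I * n * τ) + -(n * (2 * Real.pi * I))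
      by ring, exp_add, exp_neg (n * _), exp_nat_mul_two_pi_mul_I, inv_one, mul_one]
  rw [integrand, h, h', integrand]

theorem norm_exp_two_pi_I_mul (τ : ℂ) :
    ‖exp (2 * Real.pi * I * τ)‖ = Real.exp (-(2 * Real.pi * τ.im)) := by
  rw [norm_exp]
  congr 1
  simp

theorem norm_exp_two_pi_I_mul_lt_one {τ : ℂ} (hτ : 0 < τ.im) : ‖exp (2 * Real.pi * I * τ)‖ < 1 := by
  rw [norm_exp_two_pi_I_mul, Real.exp_lt_one_iff]
  have := Real.pi_pos
  simp only [Left.neg_neg_iff]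
  positivity

theorem continuousOn_integrand (n : ℕ) : ContinuousOn (integrand n) {τ | 0 < τ.im} := by
  refine ContinuousOn.mul (by fun_prop) (continuousOn_partGen.comp (by fun_prop) fun τ hτ => ?_)
  simpa using norm_exp_two_pi_I_mul_lt_one hτ

theorem continuous_integrand_line (n : ℕ) {y : ℝ} (hy : 0 < y) :
    Continuous fun x : ℝ => integrand n (x + y * I) :=
  (continuousOn_integrand n).comp_continuous (by fun_prop) fun x => by simpa using hy

theorem integral_exp_int_mul (k : ℤ) :
    ∫ x in (0 : ℝ)..1, exp (2 * Real.pi * I * k * x) = if k = 0 then 1 else 0 := by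
  split_ifs with h
  · simp [h]
  · have hc : 2 * Real.pi * I * k ≠ 0 := by
      simp [h, Real.pi_ne_zero]
    rw [integral_exp_mul_complex hc]
    have : exp (2 * Real.pi * I * k * (1 : ℝ)) = 1 := by
      rw [show 2 * Real.pi * I * k * (1 : ℝ) = k * (2 * Real.pi * I) by push_cast; ring,
        exp_int_mul_two_pi_mul_I]
    rw [this]
    simp

/-- Orthogonality of the exponentials leaves only the term m = n. Termwise integration is dominated
because |q| is constant on the segment. -/
theorem integral_integrand (n : ℕ) {y : ℝ} (hy : 0 < y) :
    ∫ x in (0 : ℝ)..1, integrand n (x + y * I) = p n := by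
  set r : ℝ := Real.exp (-(2 * Real.pi * y)) with hr
  have hq : ∀ x : ℝ, ‖exp (2 * Real.pi * I * (x + y * I))‖ = r := fun x => by
    rw [norm_exp_two_pi_I_mul]; simp [hr]
  have hq1 : r < 1 := by
    rw [← hq 0]
    exact norm_exp_two_pi_I_mul_lt_one (by simpa using hy)
  have hr0 : 0 ≤ r := (Real.exp_pos _).le
  let F : ℕ → ℝ → ℂ := fun m x => exp (-(2 * Real.pi * I * n * (x + y * I))) *
    ((p m : ℂ) * exp (2 * Real.pi * I * (x + y * I)) ^ m)
  have hF : ∀ m x, F m x = (p m : ℂ) * exp (-(2 * Real.pi * y * ((m : ℂ) - n))) *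
      exp (2 * Real.pi * I * ((m - n : ℤ) : ℂ) * x) := fun m x => by
    have e : -(2 * Real.pi * I * n * (x + y * I)) + m * (2 * Real.pi * I * (x + y * I))
        = -(2 * Real.pi * y * ((m : ℂ) - n)) + 2 * Real.pi * I * ((m - n : ℤ) : ℂ) * x := by
      push_cast
      linear_combination (2 * Real.pi * y * m - 2 * Real.pi * y * n) * I_sq
    simp only [F]
    rw [← exp_nat_mul, mul_left_comm, ← exp_add, e, exp_add, ← mul_assoc]
  have hint : ∀ m, ∫ x in (0 : ℝ)..1, F m x = if m = n then (p n : ℂ) else 0 := fun m => by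
    simp only [hF]
    rw [intervalIntegral.integral_const_mul, integral_exp_int_mul]
    by_cases h : m = n
    · subst h; simp
    · have : (m - n : ℤ) ≠ 0 := by omega
      rw [if_neg this, if_neg h, mul_zero]
  have hsum : ∀ x, HasSum (fun m => F m x) (integrand n (x + y * I)) := fun x =>
    (hasSum_partGen (by rw [hq]; exact hq1)).mul_left _
  have key := intervalIntegral.hasSum_integral_of_dominated_convergence (F := F)
    (μ := MeasureTheory.volume) (a := 0) (b := 1)
    (f := fun x => integrand n (x + y * I))
    (fun m _ => Real.exp (2 * Real.pi * n * y) * ((p m : ℝ) * r ^ m))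
    (fun m => by
      refine Continuous.aestronglyMeasurable ?_
      simp only [F]
      fun_prop)
    (fun m => .of_forall fun x _ => by
      simp only [F]
      rw [norm_mul, norm_mul, norm_pow, hq, Complex.norm_natCast, norm_exp]
      gcongr
      simp)
    (.of_forall fun x _ => (summable_partition hr0 hq1).mul_left _)
    (by simp)
    (.of_forall fun x _ => hsum x)
  simp only [hint] at key
  exact key.unique (by simpa using hasSum_ite_eq n (p n : ℂ))

end

section

open Complex Finset

/-! ### The transformation behaviour at a cusp -/

theorem eta_eq (τ : ℂ) :
    ModularForm.eta τ = exp (2 * Real.pi * I * τ / 24) * (partGen (exp (2 * Real.pi * I * τ)))⁻¹ := by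
  simp only [ModularForm.eta, partGen, inv_inv, ModularForm.eta_q_eq_pow,
    Function.Periodic.qParam, ofReal_ofNat]

theorem integrand_eq_exp_div_eta (n : ℕ) (τ : ℂ) :
    integrand n τ = exp (-(2 * Real.pi * I * (n - 1 / 24) * τ)) / ModularForm.eta τ := by
  rw [eta_eq, integrand, div_mul_eq_div_div, div_inv_eq_mul, ← exp_sub]
  congr 2
  ring

theorem etaMultiplier_spec (M : SL(2, ℤ)) (τ : ℍ) :
    ModularForm.eta ((M • τ : ℍ) : ℂ) = etaMultiplier M *
      csqrt ((M 1 0 : ℂ) * (τ : ℂ) + (M 1 1 : ℂ)) * ModularForm.eta (τ : ℂ) :=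
  (existsUnique_etaMultiplier M).choose_spec.1 τ

/-- The multiplier is a 24th root of unity, because η^24 transforms with weight 12 and no
multiplier. -/
theorem norm_etaMultiplier (M : SL(2, ℤ)) : ‖etaMultiplier M‖ = 1 := by
  have hη := ModularForm.eta_ne_zero UpperHalfPlane.I.2
  have hd : (M 1 0 : ℂ) * (UpperHalfPlane.I : ℂ) + (M 1 1 : ℂ) ≠ 0 := by
    have := UpperHalfPlane.denom_ne_zero (M : GL (Fin 2) ℝ) UpperHalfPlane.I
    simpa [UpperHalfPlane.denom] using this
  have h := eta_smul_pow M UpperHalfPlane.I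
  rw [etaMultiplier_spec, mul_pow, mul_pow, show 24 = 2 * 12 from rfl, pow_mul (csqrt _),
    csqrt_sq, ← show 24 = 2 * 12 from rfl] at h
  have h1 : etaMultiplier M ^ 24 = 1 := by
    have h2 := mul_right_cancel₀ (pow_ne_zero 24 hη) h
    exact mul_right_cancel₀ (pow_ne_zero 12 hd) (by rw [h2, one_mul])
  exact norm_eq_one_of_pow_eq_one h1 (by norm_num)

/-- The argument of i/(cw) is π/2 - arg w, strictly between 0 and π, so `csqrt` is the principal
root here and the logarithm is additive. -/
theorem csqrt_I_div {c : ℝ} (hc : 0 < c) {w : ℂ} (hw : 0 < w.re) :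
    csqrt (I / (c * w)) = exp (Real.pi * I / 4) * (c : ℂ) ^ (-1 / 2 : ℂ) * w ^ (-1 / 2 : ℂ) := by
  have hw0 : w ≠ 0 := fun h => by simp [h] at hw
  have hc0 : (c : ℂ) ≠ 0 := by exact_mod_cast hc.ne'
  have harg : |w.arg| < Real.pi / 2 := abs_arg_lt_pi_div_two_iff.mpr (Or.inl hw)
  obtain ⟨h1, h2⟩ := abs_lt.mp harg
  have hπ := Real.pi_pos
  have hlog : log (I / (c * w)) = Real.pi / 2 * I - Real.log c - log w := by
    have him : (Real.pi / 2 * I - Real.log c - log w : ℂ).im = Real.pi / 2 - w.arg := by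
      simp [log_im]
    have he : I / (c * w) = exp (Real.pi / 2 * I - Real.log c - log w) := by
      rw [exp_sub, exp_sub, exp_pi_div_two_mul_I, exp_log hw0, ← ofReal_exp, Real.exp_log hc,
        div_div]
    rw [he, log_exp (by rw [him]; linarith) (by rw [him]; linarith)]
  have hz : I / (c * w) ≠ 0 := div_ne_zero I_ne_zero (mul_ne_zero hc0 hw0)
  have ha : (I / (c * w)).arg ≠ Real.pi := by
    rw [← log_im, hlog]
    simp only [sub_im, mul_im, log_im]
    simp
    intro h
    linarith
  rw [csqrt, if_neg ha, cpow_def_of_ne_zero hz, cpow_def_of_ne_zero hc0, cpow_def_of_ne_zero hw0,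
    hlog, ← exp_add, ← exp_add, ofReal_log hc.le]
  congr 1
  ring

/-- The summands of `A c n`. -/
def cuspCoeff (n c d : ℕ) : ℂ :=
  exp (Real.pi * I / 4) * (etaMultiplier (matrixOfBottomRow c d) *
    exp (2 * Real.pi * I *
      ((-1 / 24 * (matrixOfBottomRow c d 0 0 : ℂ) + (n - 1 / 24) * (d : ℂ)) / (c : ℂ))))

theorem A_eq_sum_cuspCoeff (c n : ℕ) :
    A c n = ∑ d ∈ (range c).filter (fun d => Nat.Coprime c d), cuspCoeff n c d := by
  rw [A, kloostermanSum, mul_sum]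
  refine sum_congr rfl fun d _ => ?_
  rw [cuspCoeff]
  push_cast
  rw [show (-24 * (-1 / 24) : ℂ) = 1 by norm_num, cpow_one]

theorem norm_cuspCoeff (n c d : ℕ) : ‖cuspCoeff n c d‖ = 1 := by
  have h : ∀ x : ℝ, ‖exp (2 * Real.pi * I * x)‖ = 1 := fun x => by
    rw [norm_exp_two_pi_I_mul]; simp
  have h1 := h (1 / 8)
  have h2 := h ((-1 / 24 * (matrixOfBottomRow c d 0 0 : ℝ) + (n - 1 / 24) * (d : ℝ)) / (c : ℝ))
  push_cast at h1 h2
  rw [cuspCoeff, norm_mul, norm_mul, norm_etaMultiplier, h2,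
    show Real.pi * I / 4 = 2 * Real.pi * I * (1 / 8) by ring, h1]
  norm_num

theorem norm_A_le (c n : ℕ) : ‖A c n‖ ≤ c := by
  rw [A_eq_sum_cuspCoeff]
  refine (norm_sum_le _ _).trans ?_
  simp only [norm_cuspCoeff, sum_const, nsmul_eq_mul, mul_one]
  exact_mod_cast (card_filter_le _ _).trans (card_range c).le

theorem matrixOfBottomRow_one_zero {c d : ℕ} (h : Nat.Coprime c d) :
    matrixOfBottomRow c d 1 0 = c ∧ matrixOfBottomRow c d 1 1 = d := by
  have : Int.gcd d c = 1 := by rw [Int.gcd_natCast_natCast]; exact h.symm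
  simp [matrixOfBottomRow, this]

/-- For this τ one has cτ + d = i/(cw) and Mτ = a/c + iw. The transformation law thus trades the
point near the cusp for one whose height is Re w. -/
theorem integrand_cusp (n : ℕ) {c d : ℕ} (hc : 0 < c) (h : Nat.Coprime c d) {w : ℂ}
    (hw : 0 < w.re) :
    integrand n (-d / c + I / (c ^ 2 * w)) = cuspCoeff n c d * ((c : ℂ) ^ (-1 / 2 : ℂ) *
      w ^ (-1 / 2 : ℂ) * exp (Real.pi / 12 * w + 2 * Real.pi * (n - 1 / 24) / c ^ 2 / w)) *
      partGen (exp (2 * Real.pi * I * ((matrixOfBottomRow c d 0 0 : ℂ) / c + I * w))) := by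
  set M := matrixOfBottomRow c d with hM
  obtain ⟨h10, h11⟩ := matrixOfBottomRow_one_zero h
  rw [← hM] at h10 h11
  have hw0 : w ≠ 0 := fun h => by simp [h] at hw
  have hc0 : (c : ℂ) ≠ 0 := by exact_mod_cast hc.ne'
  have hcR : (0 : ℝ) < c := by exact_mod_cast hc
  have him : 0 < (-d / c + I / (c ^ 2 * w) : ℂ).im := by
    have e : (-d / c + I / (c ^ 2 * w) : ℂ) = ((-d / c : ℝ) : ℂ) + ((1 / c ^ 2 : ℝ) : ℂ) * (I * w⁻¹) := by
      push_cast
      field_simp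
    rw [e, add_im, ofReal_im, im_ofReal_mul, I_mul_im, inv_re, zero_add]
    have := normSq_pos.mpr hw0
    positivity
  let τ : ℍ := ⟨-d / c + I / (c ^ 2 * w), him⟩
  have hτ : (τ : ℂ) = -d / c + I / (c ^ 2 * w) := rfl
  have hden : (M 1 0 : ℂ) * (τ : ℂ) + (M 1 1 : ℂ) = I / ((c : ℝ) * w) := by
    rw [h10, h11, hτ]
    push_cast
    field_simp
    ring
  have hdet : (M 0 0 : ℂ) * d - (M 0 1 : ℂ) * c = 1 := by
    have := M.det_coe
    rw [Matrix.det_fin_two] at this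
    rw [h10, h11] at this
    exact_mod_cast this
  have hact : ((M • τ : ℍ) : ℂ) = (M 0 0 : ℂ) / c + I * w := by
    rw [UpperHalfPlane.specialLinearGroup_apply]
    have h2 : ((M 0 0 : ℂ) * (τ : ℂ) + (M 0 1 : ℂ)) / ((M 1 0 : ℂ) * (τ : ℂ) + (M 1 1 : ℂ))
        = (M 0 0 : ℂ) / c + I * w := by
      rw [hden, div_eq_iff (div_ne_zero I_ne_zero (mul_ne_zero (by exact_mod_cast hc0) hw0)), hτ]
      push_cast
      field_simp
      linear_combination (-(c : ℂ) * w) * hdet - w * c * I_sq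
    simpa using h2
  have hspec := etaMultiplier_spec M τ
  rw [hden, csqrt_I_div hcR hw, hact, eta_eq] at hspec
  have hη := ModularForm.eta_ne_zero τ.2
  have hP : partGen (exp (2 * Real.pi * I * ((M 0 0 : ℂ) / c + I * w))) ≠ 0 := by
    refine inv_ne_zero (tprod_one_sub_pow_ne_zero (norm_exp_two_pi_I_mul_lt_one ?_))
    rw [← hact]
    exact (M • τ).2
  rw [← hτ, integrand_eq_exp_div_eta, div_eq_iff hη, cuspCoeff, ← hM]
  rw [← div_eq_mul_inv, div_eq_iff hP] at hspec
  push_cast at hspec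
  -- The last factor is the leading factor of η(Mτ). It cancels the one in `hspec`; its compensation
  -- inside the other two factors is the source of -a/24 and πw/12.
  have e : exp (-(2 * Real.pi * I * (n - 1 / 24) * (τ : ℂ))) =
      exp (2 * Real.pi * I * ((-1 / 24 * (M 0 0 : ℂ) + (n - 1 / 24) * (d : ℂ)) / (c : ℂ))) *
      exp (Real.pi / 12 * w + 2 * Real.pi * (n - 1 / 24) / c ^ 2 / w) *
      exp (2 * Real.pi * I * ((M 0 0 : ℂ) / c + I * w) / 24) := by
    rw [← exp_add, ← exp_add, hτ]
    congr 1
    field_simp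
    linear_combination (24 - 576 * n - 24 * c ^ 2 * w ^ 2 : ℂ) * I_sq
  rw [e, hspec]
  ring

end

section

open Finset

/-! ### Farey dissection -/

/-- The least non-negative residue of `l⁻¹` modulo `k`. -/
def invRes (k l : ℕ) : ℕ := ((l : ZMod k)⁻¹).val

/-- The least non-negative residue of `-l⁻¹` modulo `k`. -/
def negInvRes (k l : ℕ) : ℕ := (-(l : ZMod k)⁻¹).val

theorem dvd_invRes {k l : ℕ} (hk : 0 < k) (h : Nat.Coprime k l) :
    (k : ℤ) ∣ invRes k l * l - 1 := by
  have : NeZero k := ⟨hk.ne'⟩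
  rw [← ZMod.intCast_zmod_eq_zero_iff_dvd]
  push_cast
  rw [invRes, ZMod.natCast_zmod_val, mul_comm, ZMod.coe_mul_inv_eq_one _ h.symm, sub_self]

theorem dvd_negInvRes {k l : ℕ} (hk : 0 < k) (h : Nat.Coprime k l) :
    (k : ℤ) ∣ negInvRes k l * l + 1 := by
  have : NeZero k := ⟨hk.ne'⟩
  rw [← ZMod.intCast_zmod_eq_zero_iff_dvd]
  push_cast
  rw [negInvRes, ZMod.natCast_zmod_val, mul_comm, mul_neg, ZMod.coe_mul_inv_eq_one _ h.symm,
    neg_add_cancel]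

theorem coprime_of_dvd_mul_add {k l e : ℕ} {z : ℤ} (hz : z = 1 ∨ z = -1)
    (h : (k : ℤ) ∣ e * l + z) : Nat.Coprime k e := by
  rw [← Nat.isCoprime_iff_coprime]
  obtain ⟨t, ht⟩ := h
  rcases hz with rfl | rfl
  · exact ⟨t, -l, by linarith⟩
  · exact ⟨-t, l, by linarith⟩

theorem coprime_invRes {k l : ℕ} (hk : 0 < k) (h : Nat.Coprime k l) :
    Nat.Coprime k (invRes k l) :=
  coprime_of_dvd_mul_add (Or.inr rfl) (dvd_invRes hk h)

theorem coprime_negInvRes {k l : ℕ} (hk : 0 < k) (h : Nat.Coprime k l) :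
    Nat.Coprime k (negInvRes k l) :=
  coprime_of_dvd_mul_add (Or.inl rfl) (dvd_negInvRes hk h)

/-- The positive integers `l ≤ N`, prime to `k`, with `N < k + l`: the denominators of the right
neighbours of the fractions with denominator `k` in the Farey sequence of order `N`, and likewise
of the left neighbours. -/
def fareyDenoms (N k : ℕ) : Finset ℕ := (Ioc (N - k) N).filter (Nat.Coprime k)

theorem card_fareyDenoms {N k : ℕ} (hkN : k ≤ N) : #(fareyDenoms N k) = Nat.totient k := by
  rw [← Nat.filter_coprime_Ico_eq_totient k (N - k + 1), fareyDenoms]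
  congr 2
  ext x
  simp only [mem_Ioc, mem_Ico]
  omega

/-- The denominators lie among k consecutive integers, so they represent distinct residues, and
there are φ(k) of them. An injective map into the reduced residues is then onto. -/
theorem sum_fareyDenoms_of_injective {N k : ℕ} (hkN : k ≤ N) {e : ℕ → ℕ}
    (hlt : ∀ l, Nat.Coprime k l → e l < k ∧ Nat.Coprime k (e l))
    (hinj : ∀ l l', Nat.Coprime k l → Nat.Coprime k l' → e l = e l' → (l : ZMod k) = l')
    (g : ℕ → ℂ) :
    ∑ l ∈ fareyDenoms N k, g (e l) = ∑ d ∈ (range k).filter (fun d => Nat.Coprime k d), g d := by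
  have hio : Set.InjOn e (fareyDenoms N k) := fun l hl l' hl' h => by
    simp only [fareyDenoms, coe_filter, mem_Ioc, Set.mem_ofPred_eq] at hl hl'
    have h1 := (ZMod.intCast_eq_intCast_iff_dvd_sub l l' k).mp
      (by exact_mod_cast hinj l l' hl.2 hl'.2 h)
    obtain ⟨t, ht⟩ := h1
    have ht0 : t = 0 := by
      have hk0 : (0 : ℤ) < k := by omega
      by_contra h0
      rcases lt_or_gt_of_ne h0 with h0 | h0
      · have : (k : ℤ) * t ≤ k * (-1) := mul_le_mul_of_nonneg_left (by omega) hk0.le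
        omega
      · have : (k : ℤ) * 1 ≤ k * t := mul_le_mul_of_nonneg_left (by omega) hk0.le
        omega
    rw [ht0] at ht
    omega
  have himg : (fareyDenoms N k).image e = (range k).filter (fun d => Nat.Coprime k d) := by
    refine eq_of_subset_of_card_le (fun x hx => ?_) ?_
    · obtain ⟨l, hl, rfl⟩ := mem_image.mp hx
      simpa using hlt l (mem_filter.mp hl).2
    · rw [card_image_of_injOn hio, card_fareyDenoms hkN, Nat.totient_eq_card_coprime]
  rw [← himg, sum_image hio]

theorem sum_fareyDenoms_invRes {N k : ℕ} (hk : 0 < k) (hkN : k ≤ N) (g : ℕ → ℂ) :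
    ∑ l ∈ fareyDenoms N k, g (invRes k l)
      = ∑ d ∈ (range k).filter (fun d => Nat.Coprime k d), g d := by
  have : NeZero k := ⟨hk.ne'⟩
  refine sum_fareyDenoms_of_injective hkN
    (fun l hl => ⟨ZMod.val_lt _, coprime_invRes hk hl⟩) (fun l l' hl hl' h => ?_) g
  have h1 : (l : ZMod k)⁻¹ = (l' : ZMod k)⁻¹ := ZMod.val_injective k h
  have h2 := ZMod.coe_mul_inv_eq_one l hl.symm
  have h3 := ZMod.coe_mul_inv_eq_one l' hl'.symm
  rw [h1] at h2
  calc (l : ZMod k) = l * (l' * (l' : ZMod k)⁻¹) := by rw [h3, mul_one]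
    _ = l' * (l * (l' : ZMod k)⁻¹) := by ring
    _ = l' := by rw [h2, mul_one]

theorem sum_fareyDenoms_negInvRes {N k : ℕ} (hk : 0 < k) (hkN : k ≤ N) (g : ℕ → ℂ) :
    ∑ l ∈ fareyDenoms N k, g (negInvRes k l)
      = ∑ d ∈ (range k).filter (fun d => Nat.Coprime k d), g d := by
  have : NeZero k := ⟨hk.ne'⟩
  refine sum_fareyDenoms_of_injective hkN
    (fun l hl => ⟨ZMod.val_lt _, coprime_negInvRes hk hl⟩) (fun l l' hl hl' h => ?_) g
  have h1 : (l : ZMod k)⁻¹ = (l' : ZMod k)⁻¹ := neg_injective (ZMod.val_injective k h)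
  have h2 := ZMod.coe_mul_inv_eq_one l hl.symm
  have h3 := ZMod.coe_mul_inv_eq_one l' hl'.symm
  rw [h1] at h2
  calc (l : ZMod k) = l * (l' * (l' : ZMod k)⁻¹) := by rw [h3, mul_one]
    _ = l' * (l * (l' : ZMod k)⁻¹) := by ring
    _ = l' := by rw [h2, mul_one]

/-- The integral of `f` from the cusp `-invRes k l / k` to the mediant on its right. -/
def rightArc (f : ℝ → ℂ) (k l : ℕ) : ℂ :=
  ∫ θ in (0 : ℝ)..1 / (k * (k + l)), f (-(invRes k l : ℝ) / k + θ)

/-- The integral of `f` from the mediant on the left of the cusp `-negInvRes k l / k` to the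
cusp. -/
def leftArc (f : ℝ → ℂ) (k l : ℕ) : ℂ :=
  ∫ θ in (-(1 / (k * (k + l)) : ℝ))..0, f (-(negInvRes k l : ℝ) / k + θ)

/-- The integral of `f` over the interval between two neighbours, with the denominators
`b` and `d`, in a Farey sequence. -/
def fareyArc (f : ℝ → ℂ) (b d : ℕ) : ℂ :=
  if Nat.Coprime b d then ∫ θ in (0 : ℝ)..1 / (b * d), f (-(invRes b d : ℝ) / b + θ) else 0

theorem periodic_add_div {f : ℝ → ℂ} (hf : Function.Periodic f 1) {b : ℕ} (hb : 0 < b) {r s : ℤ}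
    (h : (b : ℤ) ∣ r - s) (θ : ℝ) : f ((r : ℝ) / b + θ) = f ((s : ℝ) / b + θ) := by
  obtain ⟨t, ht⟩ := h
  have hb' : (b : ℝ) ≠ 0 := by exact_mod_cast hb.ne'
  have e : (r : ℝ) / b + θ = (s : ℝ) / b + θ + t * 1 := by
    have : (r : ℝ) = s + b * t := by
      have : r = s + b * t := by linarith
      exact_mod_cast this
    rw [this]
    field_simp
    ring
  rw [e, hf.int_mul]

/-- Write r for `invRes b d` and rd - 1 = bt. The right end of the arc is -r/b + 1/(bd) = -t/d, and
tb ≡ -1 modulo d. Modulo 1 it is therefore the cusp from which `leftArc f d b` is measured, and the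
mediant splits the arc. -/
theorem fareyArc_eq_rightArc_add_leftArc {f : ℝ → ℂ} (hf : Function.Periodic f 1)
    (hc : Continuous f) {b d : ℕ} (hb : 0 < b) (hd : 0 < d) (h : Nat.Coprime b d) :
    fareyArc f b d = rightArc f b d + leftArc f d b := by
  have hbR : (0 : ℝ) < b := by exact_mod_cast hb
  have hdR : (0 : ℝ) < d := by exact_mod_cast hd
  have hint : ∀ x y : ℝ, IntervalIntegrable (fun θ => f (-(invRes b d : ℝ) / b + θ))
      MeasureTheory.volume x y := fun x y => Continuous.intervalIntegrable (by fun_prop) _ _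
  rw [fareyArc, if_pos h, rightArc, leftArc,
    ← intervalIntegral.integral_add_adjacent_intervals (hint 0 (1 / (b * (b + d)))) (hint _ _)]
  congr 1
  obtain ⟨t, ht⟩ := dvd_invRes hb h
  have hdvd : (d : ℤ) ∣ (-t) - (-(negInvRes d b : ℤ)) := by
    obtain ⟨s, hs⟩ := dvd_negInvRes hd h.symm
    have : (d : ℤ) ∣ ((-t) - (-(negInvRes d b : ℤ))) * b :=
      ⟨s - invRes b d, by linear_combination ht + hs⟩
    exact (Nat.isCoprime_iff_coprime.mpr h.symm).dvd_of_dvd_mul_right this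
  have h1 : ∀ θ : ℝ, f (-(negInvRes d b : ℝ) / d + θ)
      = f (-(invRes b d : ℝ) / b + (1 / (b * d) + θ)) := fun θ => by
    have := periodic_add_div hf hd hdvd θ
    push_cast at this
    rw [← this, ← add_assoc]
    congr 2
    have ht' : (invRes b d : ℝ) * d - 1 = b * t := by exact_mod_cast ht
    field_simp
    linear_combination ht'
  simp only [h1]
  rw [intervalIntegral.integral_comp_add_left (fun θ => f (-(invRes b d : ℝ) / b + θ))]
  congr 1
  · field_simp
    ring
  · ring

/-- The mediant divides the length as 1/(bd) = 1/(b(b+d)) + 1/((b+d)d), and the left cusp is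
unchanged since b + d ≡ d modulo b. For pairs that are not coprime all three terms are 0. -/
theorem fareyArc_mediant {f : ℝ → ℂ} (hf : Function.Periodic f 1) (hc : Continuous f) {b d : ℕ}
    (hb : 0 < b) (hd : 0 < d) :
    fareyArc f b d = fareyArc f b (b + d) + fareyArc f (b + d) d := by
  by_cases h : Nat.Coprime b d
  swap
  · rw [fareyArc, if_neg h, fareyArc, if_neg (by simpa using h), fareyArc, if_neg (by simpa using h),
      add_zero]
  have hbR : (0 : ℝ) < b := by exact_mod_cast hb
  have hdR : (0 : ℝ) < d := by exact_mod_cast hd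
  have hbd : Nat.Coprime (b + d) d := by simpa using h
  have hint : ∀ x y : ℝ, IntervalIntegrable (fun θ => f (-(invRes b d : ℝ) / b + θ))
      MeasureTheory.volume x y := fun x y => Continuous.intervalIntegrable (by fun_prop) _ _
  have hinv : invRes b (b + d) = invRes b d := by simp [invRes]
  rw [fareyArc, if_pos h, fareyArc, if_pos (by simpa using h), fareyArc, if_pos hbd, hinv,
    ← intervalIntegral.integral_add_adjacent_intervals (hint 0 (1 / (b * (b + d)))) (hint _ _)]
  push_cast
  congr 1
  obtain ⟨t, ht⟩ := dvd_invRes hb h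
  have hdvd : ((b + d : ℕ) : ℤ) ∣ (-t - invRes b d) - (-(invRes (b + d) d : ℤ)) := by
    obtain ⟨s, hs⟩ := dvd_invRes (by omega) hbd
    have : ((b + d : ℕ) : ℤ) ∣ ((-t - invRes b d) - (-(invRes (b + d) d : ℤ))) * d :=
      ⟨s - t, by push_cast at hs ⊢; linear_combination hs - ht⟩
    exact (Nat.isCoprime_iff_coprime.mpr hbd).dvd_of_dvd_mul_right this
  have h1 : ∀ θ : ℝ, f (-(invRes (b + d) d : ℝ) / (b + d) + θ)
      = f (-(invRes b d : ℝ) / b + (1 / (b * (b + d)) + θ)) := fun θ => by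
    have := periodic_add_div hf (by omega) hdvd θ
    push_cast at this
    rw [← this, ← add_assoc]
    congr 2
    have ht' : (invRes b d : ℝ) * d - 1 = b * t := by exact_mod_cast ht
    field_simp
    linear_combination ht'
  simp only [h1]
  rw [intervalIntegral.integral_comp_add_left (fun θ => f (-(invRes b d : ℝ) / b + θ))]
  congr 1
  · ring
  · field_simp
    ring

/-- Raising the order to N + 1 splits exactly the pairs with b + d = N + 1, each by a mediant of
denominator N + 1. Coprimality is not tracked, since `h` vanishes where it fails; only the new pair
(N + 1, N + 1) needs `hdiag`. -/
theorem sum_farey_pairs_succ {h : ℕ → ℕ → ℂ}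
    (hmed : ∀ b d, 0 < b → 0 < d → h b d = h b (b + d) + h (b + d) d)
    (hdiag : ∀ b, 1 < b → h b b = 0) {N : ℕ} (hN : 1 ≤ N) :
    ∑ b ∈ Icc 1 (N + 1), ∑ d ∈ Icc 1 (N + 1), (if N + 1 < b + d then h b d else 0)
      = ∑ b ∈ Icc 1 N, ∑ d ∈ Icc 1 N, (if N < b + d then h b d else 0) := by
  have hl : ∀ b ∈ Icc 1 N, ∑ d ∈ Icc 1 N, (if N < b + d then h b d else 0)
      = ∑ d ∈ Icc 1 N, (if N + 1 < b + d then h b d else 0)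
        + (h b (N + 1) + h (N + 1) (N + 1 - b)) := fun b hb => by
    rw [mem_Icc] at hb
    have h1 : ∀ d ∈ Icc 1 N, (if N < b + d then h b d else 0)
        = (if N + 1 < b + d then h b d else 0) + if N + 1 - b = d then h b d else 0 := fun d _ => by
      split_ifs <;> first | omega | simp
    rw [sum_congr rfl h1, sum_add_distrib, sum_ite_eq, if_pos (by rw [mem_Icc]; omega),
      hmed b (N + 1 - b) (by omega) (by omega), show b + (N + 1 - b) = N + 1 by omega]
  have hflip : ∑ b ∈ Icc 1 N, h (N + 1) (N + 1 - b) = ∑ d ∈ Icc 1 N, h (N + 1) d := by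
    refine sum_nbij' (fun b => N + 1 - b) (fun b => N + 1 - b) ?_ ?_ ?_ ?_ ?_ <;>
      simp only [mem_Icc] <;> intros <;> first | omega | trivial
  rw [sum_congr rfl hl, sum_Icc_succ_top (by omega)]
  simp only [sum_Icc_succ_top (show 1 ≤ N + 1 by omega)]
  rw [sum_add_distrib, sum_add_distrib, sum_add_distrib, hflip,
    if_pos (show N + 1 < N + 1 + (N + 1) by omega), hdiag _ (by omega)]
  have h2 : ∑ b ∈ Icc 1 N, (if N + 1 < b + (N + 1) then h b (N + 1) else 0)
      = ∑ b ∈ Icc 1 N, h b (N + 1) :=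
    sum_congr rfl fun b hb => by rw [mem_Icc] at hb; rw [if_pos (by omega)]
  have h3 : ∑ d ∈ Icc 1 N, (if N + 1 < N + 1 + d then h (N + 1) d else 0)
      = ∑ d ∈ Icc 1 N, h (N + 1) d :=
    sum_congr rfl fun b hb => by rw [mem_Icc] at hb; rw [if_pos (by omega)]
  rw [h2, h3]
  ring

theorem integral_eq_sum_fareyArc {f : ℝ → ℂ} (hf : Function.Periodic f 1) (hc : Continuous f)
    {N : ℕ} (hN : 1 ≤ N) :
    ∫ x in (0 : ℝ)..1, f x
      = ∑ b ∈ Icc 1 N, ∑ d ∈ Icc 1 N, (if N < b + d then fareyArc f b d else 0) := by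
  induction N, hN using Nat.le_induction with
  -- In order 1 the only pair is (1, 1), whose arc is the whole unit interval starting at 0.
  | base => simp [fareyArc, invRes, Subsingleton.elim _ (0 : ZMod 1)]
  | succ N hN ih =>
    rw [ih, sum_farey_pairs_succ (fun b d hb hd => fareyArc_mediant hf hc hb hd) _ hN]
    intro b hb
    rw [fareyArc, if_neg]
    rw [Nat.coprime_self]
    omega

/-- The Farey dissection of order `N` of the integral of a function with period `1`. -/
theorem integral_eq_sum_arcs {f : ℝ → ℂ} (hf : Function.Periodic f 1) (hc : Continuous f)
    {N : ℕ} (hN : 1 ≤ N) :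
    ∫ x in (0 : ℝ)..1, f x
      = ∑ k ∈ Icc 1 N, ∑ l ∈ fareyDenoms N k, (rightArc f k l + leftArc f k l) := by
  have hset : ∀ k ∈ Icc 1 N, ∀ g : ℕ → ℂ, ∑ l ∈ fareyDenoms N k, g l
      = ∑ l ∈ Icc 1 N, if N < k + l ∧ Nat.Coprime k l then g l else 0 := fun k hk g => by
    rw [mem_Icc] at hk
    rw [← sum_filter]
    congr 1
    ext l
    simp only [fareyDenoms, mem_filter, mem_Ioc, mem_Icc]
    constructor
    · rintro ⟨h1, h2⟩
      exact ⟨by omega, by omega, h2⟩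
    · rintro ⟨h1, h2, h3⟩
      exact ⟨by omega, h3⟩
  have h1 : ∀ b ∈ Icc 1 N, ∀ d ∈ Icc 1 N, (if N < b + d then fareyArc f b d else 0)
      = (if N < b + d ∧ Nat.Coprime b d then rightArc f b d else 0)
        + if N < d + b ∧ Nat.Coprime d b then leftArc f d b else 0 := fun b hb d hd => by
    rw [mem_Icc] at hb hd
    by_cases hlt : N < b + d
    · by_cases hcop : Nat.Coprime b d
      · rw [if_pos hlt, if_pos ⟨hlt, hcop⟩, if_pos ⟨by omega, hcop.symm⟩,
          fareyArc_eq_rightArc_add_leftArc hf hc (by omega) (by omega) hcop]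
      · rw [if_pos hlt, if_neg (fun h => hcop h.2), if_neg (fun h => hcop h.2.symm), fareyArc,
          if_neg hcop, add_zero]
    · rw [if_neg hlt, if_neg (fun h => hlt h.1), if_neg (fun h => hlt (by omega)), add_zero]
  rw [integral_eq_sum_fareyArc hf hc hN]
  simp only [sum_add_distrib]
  rw [sum_congr rfl fun b hb => sum_congr rfl (h1 b hb)]
  simp only [sum_add_distrib]
  -- A left arc belongs to the cusp at the right end of its pair; exchanging the sums indexes it by
  -- the denominator of its own cusp.
  rw [sum_comm (f := fun b d => if N < d + b ∧ Nat.Coprime d b then leftArc f d b else 0)]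
  congr 1 <;> exact sum_congr rfl fun k hk => (hset k hk _).symm

end

section

open Complex Filter Topology MeasureTheory

/-! ### The main term of the integrand in the right half plane -/

/-- The half plane is the increasing union of the discs around m + 1 of radius m + 1, all containing
1. Primitives on the discs, normalised to vanish at 1, agree and can be glued. A global primitive
replaces all deformation of contours. -/
theorem exists_primitive_rightHalfPlane {f : ℂ → ℂ} (hf : DifferentiableOn ℂ f {w | 0 < w.re}) :
    ∃ Φ : ℂ → ℂ, ∀ w, 0 < w.re → HasDerivAt Φ (f w) w := by
  have hball : ∀ m : ℕ, Metric.ball ((m : ℂ) + 1) (m + 1) ⊆ {w : ℂ | 0 < w.re} := fun m w hw => by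
    have h1 : |(w - (m + 1)).re| < m + 1 := (abs_re_le_norm _).trans_lt (by simpa [dist_eq] using hw)
    have h2 := (abs_lt.mp h1).1
    simp at h2
    show 0 < w.re
    linarith
  have hmono : ∀ {m k : ℕ}, m ≤ k →
      Metric.ball ((m : ℂ) + 1) (m + 1) ⊆ Metric.ball ((k : ℂ) + 1) (k + 1) := fun {m k} hmk => by
    refine Metric.ball_subset_ball' ?_
    have : dist ((m : ℂ) + 1) (k + 1) = k - m := by
      rw [dist_eq, show ((m : ℂ) + 1 - (k + 1)) = ((m - k : ℝ) : ℂ) by push_cast; ring, norm_real,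
        Real.norm_eq_abs, abs_sub_comm, abs_of_nonneg]
      have : (m : ℝ) ≤ k := by exact_mod_cast hmk
      linarith
    rw [this]
    linarith
  have hone : ∀ m : ℕ, (1 : ℂ) ∈ Metric.ball ((m : ℂ) + 1) (m + 1) := fun m => by
    simp
  have hex : ∀ m : ℕ, ∃ g : ℂ → ℂ, g 1 = 0 ∧
      ∀ w ∈ Metric.ball ((m : ℂ) + 1) (m + 1), HasDerivAt g (f w) w := fun m =>
    ((hf.mono (hball m)).isExactOn_ball).with_val_at 1 0
  choose g hg1 hg using hex
  have hagree : ∀ {m k : ℕ}, m ≤ k → ∀ w ∈ Metric.ball ((m : ℂ) + 1) (m + 1), g m w = g k w := by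
    intro m k hmk w hw
    have hconst := (convex_ball ((m : ℂ) + 1) (m + 1)).is_const_of_fderivWithin_eq_zero (𝕜 := ℂ)
      (f := g m - g k)
      (fun z hz => ((hg m z hz).sub (hg k z (hmono hmk hz))).differentiableAt.differentiableWithinAt)
      (fun z hz => by
        have h0 := (hg m z hz).sub (hg k z (hmono hmk hz))
        rw [sub_self] at h0
        rw [(h0.hasFDerivAt.hasFDerivWithinAt).fderivWithin
          (Metric.isOpen_ball.uniqueDiffWithinAt hz)]
        ext
        simp)
      hw (hone m)
    simpa [hg1, sub_eq_zero] using hconst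
  have hcover : ∀ w : ℂ, 0 < w.re → ∃ m : ℕ, w ∈ Metric.ball ((m : ℂ) + 1) (m + 1) := fun w hw => by
    -- Membership in the m-th disc means |w|² < 2(m + 1) Re w.
    obtain ⟨m, hm⟩ := exists_nat_gt ((w.re ^ 2 + w.im ^ 2) / (2 * w.re))
    refine ⟨m, ?_⟩
    rw [div_lt_iff₀ (by positivity)] at hm
    rw [Metric.mem_ball, dist_eq_re_im, Real.sqrt_lt' (by positivity)]
    simp
    nlinarith
  choose! N hN using hcover
  refine ⟨fun w => g (N w) w, fun w hw => ?_⟩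
  refine (hg _ w (hN w hw)).congr_of_eventuallyEq ?_
  filter_upwards [Metric.isOpen_ball.mem_nhds (hN w hw)] with z hz
  have hz' := hN z (hball _ hz)
  rcases le_total (N z) (N w) with h | h
  · exact hagree h z hz'
  · exact (hagree h z hz).symm

/-- The function `w ^ (-5/2) e ^ (π w / 12 + β / w)`. -/
def kernel (β : ℝ) (w : ℂ) : ℂ := w ^ (-5 / 2 : ℂ) * exp (Real.pi / 12 * w + β / w)

theorem differentiableOn_kernel (β : ℝ) : DifferentiableOn ℂ (kernel β) {w | 0 < w.re} := by
  intro w hw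
  have hw' : 0 < w.re := hw
  have hw0 : w ≠ 0 := fun h => by simp [h] at hw'
  have h1 : w ∈ slitPlane := Or.inl hw'
  refine DifferentiableAt.differentiableWithinAt ?_
  unfold kernel
  refine DifferentiableAt.mul ?_ ?_
  · exact differentiableAt_id.cpow (differentiableAt_const _) h1
  · exact ((differentiableAt_id.const_mul _).add
      ((differentiableAt_const _).div differentiableAt_id hw0)).cexp

theorem norm_cpow_neg_five_halves (w : ℂ) : ‖w ^ (-5 / 2 : ℂ)‖ = ‖w‖ ^ (-5 / 2 : ℝ) := by
  rw [← norm_cpow_real]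
  norm_num

/-- In this strip Re(πw/12) ≤ π/3 and Re(1/w) ≤ 1/|w| ≤ 2. The bound uses B instead of β to be
uniform in the denominator k. -/
theorem norm_exp_kernel_le {β B : ℝ} (hβ : 0 ≤ β) (hβB : β ≤ B) {w : ℂ} (h1 : 1 / 2 ≤ w.re)
    (h2 : w.re ≤ 4) :
    ‖exp (Real.pi / 12 * w + β / w)‖ ≤ Real.exp (Real.pi / 3 + 2 * B) := by
  rw [norm_exp, Real.exp_le_exp]
  have hre : (Real.pi / 12 * w + β / w : ℂ).re = Real.pi / 12 * w.re + β * (w⁻¹).re := by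
    rw [div_eq_mul_inv (β : ℂ), add_re, re_ofReal_mul,
      show (Real.pi / 12 : ℂ) = ((Real.pi / 12 : ℝ) : ℂ) by push_cast; rfl, re_ofReal_mul]
  have hinv : (w⁻¹).re ≤ 2 := by
    refine (re_le_norm _).trans ?_
    rw [norm_inv]
    have : 1 / 2 ≤ ‖w‖ := h1.trans (re_le_norm w)
    rw [inv_le_comm₀ (by linarith) (by norm_num)]
    linarith
  have hπ := Real.pi_pos
  rw [hre]
  have := mul_le_mul_of_nonneg_left hinv hβ
  nlinarith

theorem norm_kernel_le {β B : ℝ} (hβ : 0 ≤ β) (hβB : β ≤ B) {w : ℂ} (h1 : 1 / 2 ≤ w.re)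
    (h2 : w.re ≤ 4) :
    ‖kernel β w‖ ≤ Real.exp (Real.pi / 3 + 2 * B) * ‖w‖ ^ (-5 / 2 : ℝ) := by
  rw [kernel, norm_mul, norm_cpow_neg_five_halves, mul_comm]
  exact mul_le_mul_of_nonneg_right (norm_exp_kernel_le hβ hβB h1 h2) (by positivity)

theorem norm_kernel_le_of_le_im {β B : ℝ} (hβ : 0 ≤ β) (hβB : β ≤ B) {w : ℂ} (h1 : 1 / 2 ≤ w.re)
    (h2 : w.re ≤ 4) {t : ℝ} (ht : 0 < t) (hw : t ≤ |w.im|) :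
    ‖kernel β w‖ ≤ Real.exp (Real.pi / 3 + 2 * B) * t ^ (-5 / 2 : ℝ) := by
  refine (norm_kernel_le hβ hβB h1 h2).trans ?_
  refine mul_le_mul_of_nonneg_left ?_ (Real.exp_pos _).le
  exact Real.rpow_le_rpow_of_nonpos ht (hw.trans (abs_im_le_norm w)) (by norm_num)

theorem continuous_kernel_vertical (β : ℝ) {u : ℝ} (hu : 0 < u) (s : ℝ) :
    Continuous fun t : ℝ => kernel β (u + s * t * I) :=
  (differentiableOn_kernel β).continuousOn.comp_continuous (by fun_prop) fun t => by simpa using hu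

/-- The kernel is O(t^(-5/2)) at height t, and integrating from v to T gives at most 2/3 of
v^(-3/2). The sign `s` covers both vertical directions. -/
theorem norm_primitive_sub_le {β B : ℝ} (hβ : 0 ≤ β) (hβB : β ≤ B) {Φ : ℂ → ℂ}
    (hΦ : ∀ w, 0 < w.re → HasDerivAt Φ (kernel β w) w) {s : ℝ} (hs : |s| = 1) {u v T : ℝ}
    (hu1 : 1 / 2 ≤ u) (hu2 : u ≤ 4) (hv : 0 < v) (hvT : v ≤ T) :
    ‖Φ (u + s * T * I) - Φ (u + s * v * I)‖
      ≤ Real.exp (Real.pi / 3 + 2 * B) * v ^ (-3 / 2 : ℝ) := by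
  have hu : 0 < u := by linarith
  set C := Real.exp (Real.pi / 3 + 2 * B)
  have hC : 0 < C := Real.exp_pos _
  have hd : ∀ t : ℝ, HasDerivAt (fun t : ℝ => Φ (u + s * t * I))
      (kernel β (u + s * t * I) * (s * I)) t := fun t => by
    have h1 : HasDerivAt (fun t : ℝ => (u + s * t * I : ℂ)) (s * I) t := by
      have := ((((hasDerivAt_id t).ofReal_comp).const_mul (s : ℂ)).mul_const I).const_add (u : ℂ)
      simpa using this
    exact (hΦ _ (by simpa using hu)).comp t h1
  have hcont := (continuous_kernel_vertical β hu s).mul (continuous_const (y := (s * I : ℂ)))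
  rw [← intervalIntegral.integral_eq_sub_of_hasDerivAt (fun t _ => hd t)
    (hcont.intervalIntegrable _ _)]
  have hint : IntervalIntegrable (fun t : ℝ => C * t ^ (-5 / 2 : ℝ)) volume v T :=
    (intervalIntegral.intervalIntegrable_rpow (Or.inr (by
      rw [Set.uIcc_of_le hvT]; exact fun h => absurd h.1 (by linarith)))).const_mul _
  refine (intervalIntegral.norm_integral_le_of_norm_le hvT (.of_forall fun t ht => ?_) hint).trans ?_
  · have ht0 : 0 < t := hv.trans ht.1
    rw [norm_mul, norm_mul, norm_I, norm_real, Real.norm_eq_abs, hs, mul_one, mul_one]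
    refine norm_kernel_le_of_le_im hβ hβB (by simpa using hu1) (by simpa using hu2) ht0 ?_
    simp [abs_mul, hs, abs_of_pos ht0]
  · rw [intervalIntegral.integral_const_mul, integral_rpow (Or.inr ⟨by norm_num, by
      rw [Set.uIcc_of_le hvT]; exact fun h => absurd h.1 (by linarith)⟩)]
    refine mul_le_mul_of_nonneg_left ?_ hC.le
    norm_num
    have h1 : 0 ≤ T ^ (-3 / 2 : ℝ) := Real.rpow_nonneg (by linarith) _
    have h2 : 0 ≤ v ^ (-3 / 2 : ℝ) := Real.rpow_nonneg hv.le _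
    linarith

/-- Moving horizontally from abscissa 1 to u at height T changes Φ by O(T^(-5/2)), so the limit on
the line Re w = 1 is also the limit on Re w = u. -/
theorem norm_limit_sub_primitive_le {β B : ℝ} (hβ : 0 ≤ β) (hβB : β ≤ B) {Φ : ℂ → ℂ}
    (hΦ : ∀ w, 0 < w.re → HasDerivAt Φ (kernel β w) w) {s : ℝ} (hs : |s| = 1) {L : ℂ}
    (hL : Tendsto (fun T : ℝ => Φ ((1 : ℝ) + s * T * I)) atTop (𝓝 L)) {u v : ℝ}
    (hu1 : 1 / 2 ≤ u) (hu2 : u ≤ 4) (hv : 0 < v) :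
    ‖L - Φ (u + s * v * I)‖ ≤ Real.exp (Real.pi / 3 + 2 * B) * v ^ (-3 / 2 : ℝ) := by
  set C := Real.exp (Real.pi / 3 + 2 * B) with hCdef
  have hdiff : Tendsto (fun T : ℝ => Φ (u + s * T * I) - Φ ((1 : ℝ) + s * T * I)) atTop (𝓝 0) := by
    refine squeeze_zero_norm' (a := fun T : ℝ => C * T ^ (-5 / 2 : ℝ) * |u - 1|) ?_ ?_
    · filter_upwards [eventually_gt_atTop 0] with T hT
      have hseg : ∀ x ∈ Set.uIcc 1 u, 1 / 2 ≤ x ∧ x ≤ 4 := fun x hx => by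
        rcases Set.mem_uIcc.mp hx with h | h <;> constructor <;> linarith [h.1, h.2]
      have hd : ∀ x ∈ Set.uIcc 1 u, HasDerivAt (fun x : ℝ => Φ (x + s * T * I))
          (kernel β (x + s * T * I)) x := fun x hx => by
        have h1 : HasDerivAt (fun x : ℝ => (x + s * T * I : ℂ)) 1 x := by
          simpa using ((hasDerivAt_id x).ofReal_comp).add_const (s * T * I : ℂ)
        have := (hΦ (x + s * T * I) (by simpa using (by linarith [(hseg x hx).1] : (0 : ℝ) < x))).comp
          x h1
        rwa [mul_one] at this
      have := (convex_uIcc 1 u).norm_image_sub_le_of_norm_hasDerivWithin_le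
        (C := C * T ^ (-5 / 2 : ℝ)) (fun x hx => (hd x hx).hasDerivWithinAt) (fun x hx => ?_)
        Set.left_mem_uIcc Set.right_mem_uIcc
      · simpa using this
      · refine norm_kernel_le_of_le_im hβ hβB (by simpa using (hseg x hx).1)
          (by simpa using (hseg x hx).2) hT ?_
        simp [abs_mul, hs, abs_of_pos hT]
    · have h := tendsto_rpow_neg_atTop (show (0 : ℝ) < 5 / 2 by norm_num)
      have h2 := (h.const_mul C).mul_const |u - 1|
      simpa [neg_div] using h2
  have hL' : Tendsto (fun T : ℝ => Φ (u + s * T * I)) atTop (𝓝 L) := by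
    simpa using hdiff.add hL
  refine le_of_tendsto ((hL'.sub_const _).norm) ?_
  filter_upwards [eventually_ge_atTop v] with T hT
  exact norm_primitive_sub_le hβ hβB hΦ hs hu1 hu2 hv hT

/-- The integral of `w ^ (-5/2) e ^ (π w / 12 + β / w)` over the line `Re w = 1`. -/
def lineIntegral (β : ℝ) : ℂ := ∫ t : ℝ, kernel β (1 + t * I)

theorem norm_kernel_line_le {β B : ℝ} (hβ : 0 ≤ β) (hβB : β ≤ B) (t : ℝ) :
    ‖kernel β (1 + t * I)‖ ≤ Real.exp (Real.pi / 3 + 2 * B) * (1 + t ^ 2)⁻¹ := by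
  refine (norm_kernel_le hβ hβB (by norm_num) (by norm_num)).trans ?_
  refine mul_le_mul_of_nonneg_left ?_ (Real.exp_pos _).le
  have hn : ‖(1 + t * I : ℂ)‖ ^ 2 = 1 + t ^ 2 := by
    rw [← normSq_eq_norm_sq, normSq_apply]
    simp
    ring
  have h1 : 1 ≤ ‖(1 + t * I : ℂ)‖ := by
    have := re_le_norm (1 + t * I : ℂ)
    simpa using this
  rw [← hn, ← Real.rpow_natCast, ← Real.rpow_neg (by positivity)]
  exact Real.rpow_le_rpow_of_exponent_le h1 (by norm_num)

theorem integrable_kernel_line {β : ℝ} (hβ : 0 ≤ β) :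
    Integrable fun t : ℝ => kernel β (1 + t * I) := by
  refine (integrable_inv_one_add_sq.const_mul (Real.exp (Real.pi / 3 + 2 * β))).mono' ?_
    (.of_forall (norm_kernel_line_le hβ le_rfl))
  have := continuous_kernel_vertical β one_pos 1
  simp at this
  exact this.aestronglyMeasurable

theorem norm_lineIntegral_le {β B : ℝ} (hβ : 0 ≤ β) (hβB : β ≤ B) :
    ‖lineIntegral β‖ ≤ Real.exp (Real.pi / 3 + 2 * B) * Real.pi := by
  refine (norm_integral_le_of_norm_le (integrable_inv_one_add_sq.const_mul _)
    (.of_forall (norm_kernel_line_le hβ hβB))).trans (le_of_eq ?_)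
  rw [integral_const_mul, integral_univ_inv_one_add_sq]

/-- The integral of the kernel from `w₀` to `∞` in the upper or the lower part of the right half
plane is approximated by integrals over finite paths. -/
theorem exists_primitive_kernel {β B : ℝ} (hβ : 0 ≤ β) (hβB : β ≤ B) :
    ∃ (Φ : ℂ → ℂ) (L L' : ℂ), (∀ w, 0 < w.re → HasDerivAt Φ (kernel β w) w) ∧
      L - L' = I * lineIntegral β ∧
      (∀ u v : ℝ, 1 / 2 ≤ u → u ≤ 4 → 0 < v →
        ‖L - Φ (u + v * I)‖ ≤ Real.exp (Real.pi / 3 + 2 * B) * v ^ (-3 / 2 : ℝ)) ∧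
      (∀ u v : ℝ, 1 / 2 ≤ u → u ≤ 4 → 0 < v →
        ‖L' - Φ (u - v * I)‖ ≤ Real.exp (Real.pi / 3 + 2 * B) * v ^ (-3 / 2 : ℝ)) := by
  obtain ⟨Φ, hΦ⟩ := exists_primitive_rightHalfPlane (differentiableOn_kernel β)
  have hint := integrable_kernel_line hβ
  have hcont : Continuous fun t : ℝ => kernel β (1 + t * I) := by
    have := continuous_kernel_vertical β one_pos 1
    simpa using this
  have hd : ∀ t : ℝ, HasDerivAt (fun t : ℝ => Φ (1 + t * I)) (I * kernel β (1 + t * I)) t :=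
    fun t => by
      have h1 : HasDerivAt (fun t : ℝ => (1 + t * I : ℂ)) I t := by
        simpa using (((hasDerivAt_id t).ofReal_comp).mul_const I).const_add (1 : ℂ)
      rw [mul_comm]
      exact (hΦ _ (by simp)).comp t h1
  have hftc : ∀ a b : ℝ, ∫ t in a..b, kernel β (1 + t * I)
      = -I * (Φ (1 + b * I) - Φ (1 + a * I)) := fun a b => by
    rw [← intervalIntegral.integral_eq_sub_of_hasDerivAt (fun t _ => hd t)
      ((continuous_const.mul hcont).intervalIntegrable _ _), intervalIntegral.integral_const_mul,
      ← mul_assoc]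
    simp
  -- The witnesses L and L' are the limits of Φ at 1 + i∞ and 1 - i∞, so their difference is the
  -- integral of the kernel along the whole line.
  have hL : Tendsto (fun T : ℝ => Φ (1 + T * I)) atTop
      (𝓝 (Φ 1 + I * ∫ t in Set.Ioi (0 : ℝ), kernel β (1 + t * I))) := by
    have h := intervalIntegral_tendsto_integral_Ioi 0 hint.integrableOn tendsto_id
    refine ((h.const_mul I).const_add (Φ 1)).congr fun T => ?_
    rw [hftc, ← mul_assoc]
    simp
  have hL' : Tendsto (fun T : ℝ => Φ (1 + (-T : ℝ) * I)) atTop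
      (𝓝 (Φ 1 - I * ∫ t in Set.Iic (0 : ℝ), kernel β (1 + t * I))) := by
    have h := intervalIntegral_tendsto_integral_Iic 0 hint.integrableOn tendsto_neg_atTop_atBot
    refine ((h.const_mul I).const_sub (Φ 1)).congr fun T => ?_
    rw [hftc, ← mul_assoc]
    simp
  refine ⟨Φ, Φ 1 + I * ∫ t in Set.Ioi (0 : ℝ), kernel β (1 + t * I),
    Φ 1 - I * ∫ t in Set.Iic (0 : ℝ), kernel β (1 + t * I), hΦ, ?_, fun u v h1 h2 hv => ?_,
    fun u v h1 h2 hv => ?_⟩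
  · rw [lineIntegral, ← intervalIntegral.integral_Iic_add_Ioi (b := 0) hint.integrableOn
      hint.integrableOn]
    ring
  · have := norm_limit_sub_primitive_le hβ hβB hΦ (s := 1) (by simp) (by simpa using hL) h1 h2 hv
    simpa using this
  · have := norm_limit_sub_primitive_le hβ hβB hΦ (s := -1) (by simp) (by simpa using hL') h1 h2 hv
    simpa [sub_eq_add_neg] using this

end

section

open Complex Filter Topology MeasureTheory
open scoped FourierTransform

/-! ### Evaluation of the line integral -/

theorem integrableOn_rpow_mul_exp_neg {s b : ℝ} (hs : -1 < s) (hb : 0 < b) :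
    IntegrableOn (fun t : ℝ => t ^ s * Real.exp (-(b * t))) (Set.Ioi 0) := by
  simpa using integrableOn_rpow_mul_exp_neg_mul_rpow hs one_pos hb

theorem norm_rpow_mul_exp {s t : ℝ} (ht : 0 < t) (r : ℂ) :
    ‖((t ^ s : ℝ) : ℂ) * exp (-(r * t))‖ = t ^ s * Real.exp (-(r.re * t)) := by
  rw [norm_mul, norm_real, Real.norm_eq_abs, abs_of_nonneg (by positivity), norm_exp]
  simp

theorem aestronglyMeasurable_rpow_mul_exp (s : ℝ) (r : ℂ) :
    AEStronglyMeasurable (fun t : ℝ => ((t ^ s : ℝ) : ℂ) * exp (-(r * t)))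
      (volume.restrict (Set.Ioi 0)) := by
  refine Measurable.aestronglyMeasurable ?_
  fun_prop

theorem integrableOn_rpow_mul_cexp_neg {s : ℝ} (hs : -1 < s) {r : ℂ} (hr : 0 < r.re) :
    IntegrableOn (fun t : ℝ => ((t ^ s : ℝ) : ℂ) * exp (-(r * t))) (Set.Ioi 0) := by
  refine (integrableOn_rpow_mul_exp_neg hs hr).mono' (aestronglyMeasurable_rpow_mul_exp s r) ?_
  filter_upwards [ae_restrict_mem measurableSet_Ioi] with t ht
  exact (norm_rpow_mul_exp ht r).le

theorem differentiableOn_laplace_rpow {s : ℝ} (hs : -1 < s) :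
    DifferentiableOn ℂ (fun r : ℂ => ∫ t in Set.Ioi (0 : ℝ), ((t ^ s : ℝ) : ℂ) * exp (-(r * t)))
      {r | 0 < r.re} := by
  intro r hr
  have hr' : 0 < r.re := hr
  have hnhds : {z : ℂ | r.re / 2 < z.re} ∈ 𝓝 r :=
    (isOpen_lt continuous_const continuous_re).mem_nhds (by
      show r.re / 2 < r.re
      linarith)
  refine (hasDerivAt_integral_of_dominated_loc_of_deriv_le
    (F := fun (r : ℂ) (t : ℝ) => ((t ^ s : ℝ) : ℂ) * exp (-(r * t)))
    (F' := fun (r : ℂ) (t : ℝ) => ((t ^ s : ℝ) : ℂ) * (exp (-(r * t)) * (-t)))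
    (bound := fun t => t ^ (s + 1) * Real.exp (-(r.re / 2 * t))) hnhds
    (.of_forall fun z => aestronglyMeasurable_rpow_mul_exp s z)
    (integrableOn_rpow_mul_cexp_neg hs hr') ?_ ?_
    (integrableOn_rpow_mul_exp_neg (by linarith) (by linarith))
    (.of_forall fun t z _ => ?_)).2.differentiableAt.differentiableWithinAt
  · refine Measurable.aestronglyMeasurable ?_
    fun_prop
  · filter_upwards [ae_restrict_mem measurableSet_Ioi] with t ht z hz
    have ht0 : (0 : ℝ) < t := ht
    rw [← mul_assoc, norm_mul, norm_rpow_mul_exp ht0, norm_neg, norm_real, Real.norm_eq_abs,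
      abs_of_pos ht0, Real.rpow_add_one ht0.ne', mul_right_comm]
    have : r.re / 2 < z.re := hz
    gcongr
  · have h : HasDerivAt (fun z : ℂ => -(z * t)) (-t) z := by
      have := (hasDerivAt_id z).mul_const (-t : ℂ)
      simp only [one_mul] at this
      refine this.congr_of_eventuallyEq (.of_forall fun z => ?_)
      simp
    exact h.cexp.const_mul _

/-- The Laplace transform of a power function. -/
theorem laplace_rpow {s : ℝ} (hs : 0 < s) {r : ℂ} (hr : 0 < r.re) :
    ∫ t in Set.Ioi (0 : ℝ), ((t ^ (s - 1) : ℝ) : ℂ) * exp (-(r * t))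
      = r ^ (-s : ℂ) * Real.Gamma s := by
  have hopen : IsOpen {r : ℂ | 0 < r.re} := isOpen_lt continuous_const continuous_re
  have hR : DifferentiableOn ℂ (fun r : ℂ => r ^ (-s : ℂ) * (Real.Gamma s : ℂ)) {r | 0 < r.re} :=
    fun z hz => ((differentiableAt_id.cpow (differentiableAt_const _)
      (show z ∈ slitPlane from Or.inl hz)).mul_const _).differentiableWithinAt
  have hreal : ∀ x : ℝ, 0 < x → ∫ t in Set.Ioi (0 : ℝ), ((t ^ (s - 1) : ℝ) : ℂ) * exp (-(x * t))
      = (x : ℂ) ^ (-s : ℂ) * Real.Gamma s := fun x hx => by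
    have h := integral_cpow_mul_exp_neg_mul_Ioi (a := s) (by simpa using hs) hx
    rw [Gamma_ofReal, one_div, inv_cpow _ _ (by rw [arg_ofReal_of_nonneg hx.le]; exact Real.pi_pos.ne),
      ← cpow_neg] at h
    rw [← h]
    refine setIntegral_congr_fun measurableSet_Ioi fun t ht => ?_
    have ht0 : (0 : ℝ) < t := ht
    rw [ofReal_cpow ht0.le]
    push_cast
    rfl
  -- Identity theorem: both sides are holomorphic in r and agree for real r > 1, which accumulate at
  -- 1.
  refine ((differentiableOn_laplace_rpow (by linarith)).analyticOnNhd hopen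
    ).eqOn_of_preconnected_of_frequently_eq (hR.analyticOnNhd hopen)
    (convex_halfSpace_re_gt 0).isPreconnected (z₀ := 1) (by simp) ?_ hr
  have htend : Tendsto (fun x : ℝ => (x : ℂ)) (𝓝[>] 1) (𝓝[≠] 1) := by
    refine tendsto_nhdsWithin_iff.mpr ⟨?_, ?_⟩
    · have : ContinuousAt (fun x : ℝ => (x : ℂ)) 1 := continuous_ofReal.continuousAt
      have h2 := this.tendsto
      rw [ofReal_one] at h2
      exact h2.mono_left nhdsWithin_le_nhds
    · filter_upwards [self_mem_nhdsWithin] with x hx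
      have hx' : (1 : ℝ) < x := hx
      simpa using hx'.ne'
  refine htend.frequently (Eventually.frequently ?_)
  filter_upwards [self_mem_nhdsWithin] with x hx
  have hx' : (1 : ℝ) < x := hx
  exact hreal x (by linarith)

theorem norm_cpow_line_le {s : ℝ} (hs : 2 ≤ s) (v : ℝ) :
    ‖(1 + v * I : ℂ) ^ (-s : ℂ)‖ ≤ (1 + v ^ 2)⁻¹ := by
  have hn : ‖(1 + v * I : ℂ)‖ ^ 2 = 1 + v ^ 2 := by
    rw [← normSq_eq_norm_sq, normSq_apply]
    simp
    ring
  have h1 : 1 ≤ ‖(1 + v * I : ℂ)‖ := by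
    have := re_le_norm (1 + v * I : ℂ)
    simpa using this
  rw [show (-s : ℂ) = ((-s : ℝ) : ℂ) by push_cast; rfl, norm_cpow_real, ← hn, ← Real.rpow_natCast,
    ← Real.rpow_neg (by positivity)]
  exact Real.rpow_le_rpow_of_exponent_le h1 (by push_cast; linarith)

theorem continuous_cpow_line (s : ℂ) : Continuous fun v : ℝ => (1 + v * I : ℂ) ^ s :=
  continuous_iff_continuousAt.mpr fun v => by
    refine ContinuousAt.cpow (by fun_prop) continuousAt_const (Or.inl (by simp))

theorem integrable_cpow_line {s : ℝ} (hs : 2 ≤ s) :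
    Integrable fun v : ℝ => (1 + v * I : ℂ) ^ (-s : ℂ) :=
  integrable_inv_one_add_sq.mono' (continuous_cpow_line _).aestronglyMeasurable
    (.of_forall (norm_cpow_line_le hs))

/-- The inverse Laplace transform of a negative power. -/
theorem integral_cpow_mul_exp_line {s : ℝ} (hs : 2 ≤ s) {a : ℝ} (ha : 0 < a) :
    ∫ v : ℝ, (1 + v * I : ℂ) ^ (-s : ℂ) * exp (a * (1 + v * I))
      = ((2 * Real.pi * a ^ (s - 1) / Real.Gamma s : ℝ) : ℂ) := by
  have hΓ : Real.Gamma s ≠ 0 := (Real.Gamma_pos_of_pos (by linarith)).ne'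
  have hπ := Real.pi_pos
  -- Its Fourier transform is Γ(s)(1 + 2πiξ)^(-s) by `laplace_rpow`, integrable since s ≥ 2. Fourier
  -- inversion at the point a gives the claim after substituting v = 2πξ.
  let f : ℝ → ℂ := (Set.Ioi (0 : ℝ)).indicator fun t => ((t ^ (s - 1) : ℝ) : ℂ) * exp (-((1 : ℂ) * t))
  have hf : Integrable f :=
    (integrableOn_rpow_mul_cexp_neg (by linarith) (by simp)).integrable_indicator measurableSet_Ioi
  have hF : ∀ ξ : ℝ, 𝓕 f ξ = (1 + (2 * Real.pi * ξ : ℝ) * I : ℂ) ^ (-s : ℂ) * Real.Gamma s :=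
    fun ξ => by
      rw [Real.fourier_real_eq_integral_exp_smul, ← laplace_rpow (by linarith) (by simp),
        ← integral_indicator measurableSet_Ioi]
      congr 1
      funext t
      by_cases ht : t ∈ Set.Ioi (0 : ℝ)
      · simp only [f, Set.indicator_of_mem ht, smul_eq_mul]
        rw [mul_left_comm, ← exp_add]
        congr 2
        push_cast
        ring
      · simp only [f, Set.indicator_of_notMem ht, smul_zero]
  have hFint : Integrable (𝓕 f) := by
    rw [funext hF]
    exact ((integrable_cpow_line hs).comp_mul_left' (R := 2 * Real.pi) (by positivity)).mul_const _
  have hcont : ContinuousAt f a := by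
    have h1 : ContinuousAt (fun t : ℝ => ((t ^ (s - 1) : ℝ) : ℂ) * exp (-((1 : ℂ) * t))) a := by
      refine ContinuousAt.mul ?_ (by fun_prop)
      exact continuous_ofReal.continuousAt.comp (Real.continuousAt_rpow_const _ _ (Or.inl ha.ne'))
    refine h1.congr ?_
    filter_upwards [isOpen_Ioi.mem_nhds (show a ∈ Set.Ioi (0 : ℝ) from ha)] with t ht
    simp only [f, Set.indicator_of_mem ht]
  have hinv := hf.fourierInv_fourier_eq hFint hcont
  rw [Real.fourierInv_eq'] at hinv
  simp only [hF] at hinv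
  have hchange := Measure.integral_comp_mul_left
    (fun v : ℝ => exp (a * v * I) * ((1 + v * I : ℂ) ^ (-s : ℂ) * Real.Gamma s)) (2 * Real.pi)
  have hfa : f a = ((a ^ (s - 1) : ℝ) : ℂ) * exp (-a) := by
    simp only [f, Set.indicator_of_mem (show a ∈ Set.Ioi (0 : ℝ) from ha), one_mul]
  have hleft : ∫ v : ℝ, exp (((2 * Real.pi * inner ℝ v a : ℝ) : ℂ) * I) •
      ((1 + (2 * Real.pi * v : ℝ) * I : ℂ) ^ (-s : ℂ) * Real.Gamma s)
      = ∫ v : ℝ, exp (a * (2 * Real.pi * v : ℝ) * I) *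
        ((1 + (2 * Real.pi * v : ℝ) * I : ℂ) ^ (-s : ℂ) * Real.Gamma s) := by
    congr 1
    funext v
    rw [smul_eq_mul]
    congr 3
    simp
    ring
  rw [hleft, hchange, hfa, abs_of_pos (by positivity)] at hinv
  have hlin : ∫ v : ℝ, exp (a * v * I) * ((1 + v * I : ℂ) ^ (-s : ℂ) * Real.Gamma s)
      = Real.Gamma s * exp (-a) * ∫ v : ℝ, (1 + v * I : ℂ) ^ (-s : ℂ) * exp (a * (1 + v * I)) := by
    rw [← integral_const_mul]
    congr 1
    funext v
    have : exp (a * v * I) = exp (-a) * exp (a * (1 + v * I)) := by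
      rw [← exp_add]
      congr 1
      ring
    rw [this]
    ring
  rw [hlin, real_smul] at hinv
  have hea : exp (-a : ℂ) ≠ 0 := exp_ne_zero _
  have hΓc : (Real.Gamma s : ℂ) ≠ 0 := by exact_mod_cast hΓ
  have hπc : (Real.pi : ℂ) ≠ 0 := by exact_mod_cast hπ.ne'
  generalize ∫ v : ℝ, (1 + v * I : ℂ) ^ (-s : ℂ) * exp (a * (1 + v * I)) = J at hinv ⊢
  push_cast at hinv ⊢
  field_simp at hinv ⊢
  linear_combination hinv

/-- Expand e^(β/w) and apply `integral_cpow_mul_exp_line` with s = 5/2 + j and a = π/12. Since |w| ≥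
1 on the line, the powers of w have a common integrable bound, and the factors β^j/j! are summable.
-/
theorem hasSum_lineIntegral {β : ℝ} (hβ : 0 ≤ β) :
    HasSum (fun j : ℕ => ((β ^ j / j.factorial * (2 * Real.pi * (Real.pi / 12) ^ (3 / 2 + j : ℝ) /
      Real.Gamma (5 / 2 + j)) : ℝ) : ℂ)) (lineIntegral β) := by
  let F : ℕ → ℝ → ℂ := fun j v => ((β ^ j / j.factorial : ℝ) : ℂ) *
    ((1 + v * I : ℂ) ^ (-((5 / 2 + j : ℝ) : ℂ)) * exp ((Real.pi / 12 : ℝ) * (1 + v * I)))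
  have hnorm : ∀ v : ℝ, ‖exp ((Real.pi / 12 : ℝ) * (1 + v * I))‖ = Real.exp (Real.pi / 12) :=
    fun v => by
      rw [norm_exp, re_ofReal_mul]
      simp
  have hs : ∀ j : ℕ, (2 : ℝ) ≤ 5 / 2 + j := fun j => by
    have : (0 : ℝ) ≤ j := by positivity
    linarith
  have hbound : ∀ j v, ‖F j v‖ ≤ β ^ j / j.factorial * (Real.exp (Real.pi / 12) * (1 + v ^ 2)⁻¹) :=
    fun j v => by
      simp only [F]
      rw [norm_mul, norm_mul, hnorm, norm_real, Real.norm_of_nonneg (by positivity),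
        mul_comm (Real.exp _)]
      gcongr
      exact norm_cpow_line_le (hs j) v
  have hbint : ∀ j : ℕ, Integrable fun v : ℝ =>
      β ^ j / j.factorial * (Real.exp (Real.pi / 12) * (1 + v ^ 2)⁻¹) := fun j =>
    (integrable_inv_one_add_sq.const_mul _).const_mul _
  have hint : ∀ j, Integrable (F j) := fun j => by
    refine (hbint j).mono' (Continuous.aestronglyMeasurable ?_) (.of_forall (hbound j))
    exact continuous_const.mul ((continuous_cpow_line _).mul (by fun_prop))
  have hsum : Summable fun j => ∫ v, ‖F j v‖ := by
    refine Summable.of_nonneg_of_le (fun j => integral_nonneg fun v => norm_nonneg _) (fun j => ?_)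
      ((Real.summable_pow_div_factorial β).mul_right (Real.exp (Real.pi / 12) * Real.pi))
    refine (integral_mono (hint j).norm (hbint j) (hbound j)).trans (le_of_eq ?_)
    rw [integral_const_mul, integral_const_mul, integral_univ_inv_one_add_sq]
  have key := hasSum_integral_of_summable_integral_norm hint hsum
  have htsum : ∀ v : ℝ, ∑' j, F j v = kernel β (1 + v * I) := fun v => by
    have hw : (1 + v * I : ℂ) ≠ 0 := fun h => by
      have := congrArg re h
      simp at this
    have hexp := (NormedSpace.expSeries_div_hasSum_exp (𝔸 := ℂ) (β / (1 + v * I))).mul_left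
      ((1 + v * I : ℂ) ^ (-5 / 2 : ℂ) * exp (Real.pi / 12 * (1 + v * I)))
    rw [← exp_eq_exp_ℂ, mul_assoc, ← exp_add, ← kernel] at hexp
    rw [← hexp.tsum_eq]
    refine tsum_congr fun j => ?_
    simp only [F]
    rw [show (-((5 / 2 + j : ℝ) : ℂ)) = -5 / 2 - (j : ℂ) by push_cast; ring, cpow_sub _ _ hw,
      cpow_natCast]
    push_cast
    rw [div_pow]
    ring
  have hterm : ∀ j : ℕ, ∫ v, F j v = ((β ^ j / j.factorial * (2 * Real.pi *
      (Real.pi / 12) ^ (3 / 2 + j : ℝ) / Real.Gamma (5 / 2 + j)) : ℝ) : ℂ) := fun j => by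
    simp only [F]
    rw [integral_const_mul, integral_cpow_mul_exp_line (hs j) (by positivity), ← ofReal_mul,
      show (5 / 2 + j - 1 : ℝ) = 3 / 2 + j by ring]
  simp only [htsum, hterm] at key
  exact key

/-- In effect the duplication formula for j! Γ(5/2 + j), proved by induction: from j to j + 1 both
sides gain the factor π²/(3(j + 1)(2j + 5)). -/
theorem gamma_coeff_eq (j : ℕ) :
    2 * Real.pi * (Real.pi / 12) ^ (3 / 2 + j : ℝ) / Real.Gamma (5 / 2 + j) / j.factorial *
      (2 * Real.pi) ^ j
      = 2 * Real.pi ^ 2 / (3 * Real.sqrt 3) * (2 * Real.pi ^ 2 / 3) ^ j *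
        ((j + 1) / (2 * j + 3).factorial) := by
  have hπ := Real.pi_pos
  have hΓ : ∀ j : ℕ, Real.Gamma (5 / 2 + j) ≠ 0 := fun j =>
    (Real.Gamma_pos_of_pos (by positivity)).ne'
  induction j with
  | zero =>
    have h1 : Real.Gamma (5 / 2) = 3 / 4 * Real.sqrt Real.pi := by
      rw [show (5 / 2 : ℝ) = 1 / 2 + 1 + 1 by norm_num, Real.Gamma_add_one (by norm_num),
        Real.Gamma_add_one (by norm_num), Real.Gamma_one_half_eq]
      ring
    have h2 : (Real.pi / 12) ^ (3 / 2 : ℝ) = Real.pi / 12 * (Real.sqrt Real.pi / (2 * Real.sqrt 3)) := by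
      rw [show (3 / 2 : ℝ) = 1 + 1 / 2 by norm_num, Real.rpow_add (by positivity), Real.rpow_one,
        ← Real.sqrt_eq_rpow, Real.sqrt_div hπ.le, show (12 : ℝ) = 2 ^ 2 * 3 by norm_num,
        Real.sqrt_mul (by norm_num), Real.sqrt_sq (by norm_num)]
    have h3 : Real.sqrt Real.pi ≠ 0 := (Real.sqrt_pos.mpr hπ).ne'
    simp only [CharP.cast_eq_zero, add_zero, h1, h2, Nat.factorial]
    field_simp
    norm_num
  | succ j ih =>
    have e1 : (5 / 2 + (j + 1 : ℕ) : ℝ) = 5 / 2 + j + 1 := by push_cast; ring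
    have e2 : (3 / 2 + (j + 1 : ℕ) : ℝ) = 3 / 2 + j + 1 := by push_cast; ring
    have e3 : (2 * (j + 1) + 3).factorial = (2 * j + 5) * ((2 * j + 4) * (2 * j + 3).factorial) := rfl
    rw [e1, e2, e3, Real.Gamma_add_one (by positivity), Real.rpow_add_one (by positivity),
      Nat.factorial_succ, pow_succ, pow_succ]
    have hf1 : ((2 * j + 3).factorial : ℝ) ≠ 0 := by positivity
    have hf2 : (j.factorial : ℝ) ≠ 0 := by positivity
    have hΓj := hΓ j
    calc _ = 2 * Real.pi * (Real.pi / 12) ^ (3 / 2 + j : ℝ) / Real.Gamma (5 / 2 + j) / j.factorial *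
          (2 * Real.pi) ^ j * (Real.pi / 12 * (2 * Real.pi) / ((5 / 2 + j) * (j + 1))) := by
          push_cast
          field_simp
      _ = _ := by
          rw [ih]
          push_cast
          field_simp
          ring

theorem hasSum_of_forall_eq {ι E : Type*} [AddCommMonoid E] [TopologicalSpace E] {f g : ι → E}
    {x : E} (hfg : ∀ i, f i = g i) (h : HasSum f x) : HasSum g x := by
  rwa [← funext hfg]

/-- The derivative of `sinh (a √(x - 1/24)) / √(x - 1/24)` as a power series. -/
theorem hasSum_deriv_sinh (a : ℝ) {x : ℝ} (hx : 1 / 24 < x) :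
    HasSum (fun j : ℕ => a ^ (2 * j + 3) * (x - 1 / 24) ^ j * ((j + 1) / (2 * j + 3).factorial))
      (deriv (fun x : ℝ => Real.sinh (a * Real.sqrt (x - 1 / 24)) / Real.sqrt (x - 1 / 24)) x) := by
  set z := Real.sqrt (x - 1 / 24) with hz
  have hy : 0 < x - 1 / 24 := by linarith
  have hz0 : 0 < z := Real.sqrt_pos.mpr hy
  have hzz : x - 1 / 24 = z ^ 2 := (Real.sq_sqrt hy.le).symm
  have hd : HasDerivAt (fun x : ℝ => Real.sinh (a * Real.sqrt (x - 1 / 24)) / Real.sqrt (x - 1 / 24))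
      ((a * z * Real.cosh (a * z) - Real.sinh (a * z)) / (2 * z ^ 3)) x := by
    have h1 : HasDerivAt (fun x : ℝ => Real.sqrt (x - 1 / 24)) (1 / (2 * z)) x :=
      ((hasDerivAt_id x).sub_const (1 / 24)).sqrt hy.ne'
    have h2 := ((h1.const_mul a).sinh).div h1 hz0.ne'
    refine HasDerivAt.congr_deriv h2 ?_
    rw [← hz]
    field_simp
  rw [hd.deriv]
  have hs : HasSum (fun j : ℕ => (a * z) ^ (2 * j + 1) * (2 * j / (2 * j + 1).factorial))
      (a * z * Real.cosh (a * z) - Real.sinh (a * z)) := by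
    refine hasSum_of_forall_eq (fun j => ?_)
      (((Real.hasSum_cosh (a * z)).mul_left (a * z)).sub (Real.hasSum_sinh (a * z)))
    rw [Nat.factorial_succ]
    push_cast
    field_simp
    ring
  -- The term j = 0 vanishes; dropping it shifts 2j + 1 to 2j + 3, and the factor z³ cancels.
  have hs' := ((hasSum_nat_add_iff' 1).mpr hs).div_const (2 * z ^ 3)
  simp only [Finset.sum_range_one, CharP.cast_eq_zero, mul_zero, zero_div, sub_zero] at hs'
  refine hasSum_of_forall_eq (fun j => ?_) hs'
  rw [hzz, show 2 * (j + 1) + 1 = 2 * j + 3 by ring]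
  push_cast
  field_simp
  ring

/-- The terms of Rademacher's series in terms of the line integral. -/
theorem lineIntegral_eq_deriv {c : ℕ} (hc : 0 < c) {x : ℝ} (hx : 1 / 24 < x) :
    (((c : ℝ) ^ (-5 / 2 : ℝ) : ℝ) : ℂ) * lineIntegral (2 * Real.pi * (x - 1 / 24) / c ^ 2)
      = (1 / (Real.pi * Real.sqrt 2) : ℂ) * ((Real.sqrt c : ℂ) *
          ((deriv (fun x : ℝ => Real.sinh (mu * Real.sqrt (x - 1 / 24) / c) /
            Real.sqrt (x - 1 / 24)) x : ℝ) : ℂ)) := by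
  have hcR : (0 : ℝ) < c := by exact_mod_cast hc
  have hπ := Real.pi_pos
  have hy : 0 < x - 1 / 24 := by linarith
  have h1 := (hasSum_lineIntegral (β := 2 * Real.pi * (x - 1 / 24) / c ^ 2) (by positivity)).mul_left
    (((c : ℝ) ^ (-5 / 2 : ℝ) : ℝ) : ℂ)
  have hfun : (fun x : ℝ => Real.sinh (mu * Real.sqrt (x - 1 / 24) / c) / Real.sqrt (x - 1 / 24))
      = fun x : ℝ => Real.sinh (mu / c * Real.sqrt (x - 1 / 24)) / Real.sqrt (x - 1 / 24) := by
    funext x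
    rw [mul_div_right_comm]
  have h2 := (hasSum_ofReal.mpr ((hasSum_deriv_sinh (mu / c) hx).mul_left
    (1 / (Real.pi * Real.sqrt 2) * Real.sqrt c)))
  rw [hfun]
  push_cast at h2
  rw [mul_assoc] at h2
  refine h1.unique (hasSum_of_forall_eq (fun j => ?_) h2)
  have hg := gamma_coeff_eq j
  have hmu2 : mu ^ 2 = 2 * Real.pi ^ 2 / 3 := by
    rw [mu, mul_pow, Real.sq_sqrt (by norm_num)]
    ring
  have hmu : mu = Real.pi * Real.sqrt 2 / Real.sqrt 3 := by
    rw [mu, Real.sqrt_div (by norm_num), mul_div_assoc]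
  have h52 : (c : ℝ) ^ (-5 / 2 : ℝ) = Real.sqrt c / c ^ 3 := by
    rw [show (-5 / 2 : ℝ) = 1 / 2 - (3 : ℕ) by norm_num, Real.rpow_sub_natCast hcR.ne',
      Real.sqrt_eq_rpow]
  have hs3 : Real.sqrt 3 ≠ 0 := by positivity
  have hs2 : Real.sqrt 2 ≠ 0 := by positivity
  -- Both sides are power series in x - 1/24, compared term by term; the constants match because μ²
  -- = 2π²/3.
  have key : (c : ℝ) ^ (-5 / 2 : ℝ) * ((2 * Real.pi * (x - 1 / 24) / c ^ 2) ^ j / j.factorial *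
      (2 * Real.pi * (Real.pi / 12) ^ (3 / 2 + j : ℝ) / Real.Gamma (5 / 2 + j)))
      = 1 / (Real.pi * Real.sqrt 2) * Real.sqrt c * ((mu / c) ^ (2 * j + 3) * (x - 1 / 24) ^ j *
        ((j + 1) / (2 * j + 3).factorial)) := by
    calc _ = Real.sqrt c / c ^ 3 * ((x - 1 / 24) ^ j / (c ^ 2) ^ j) *
        (2 * Real.pi * (Real.pi / 12) ^ (3 / 2 + j : ℝ) / Real.Gamma (5 / 2 + j) / j.factorial *
          (2 * Real.pi) ^ j) := by
          rw [h52, div_pow, mul_pow]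
          ring
      _ = _ := by
          rw [hg, ← hmu2, div_pow, pow_add mu, pow_mul mu, pow_add (c : ℝ), pow_mul (c : ℝ),
            show mu ^ 3 = mu ^ 2 * mu by ring]
          have : mu ^ 2 * mu = 2 * Real.pi ^ 2 / (3 * Real.sqrt 3) * (Real.pi * Real.sqrt 2) := by
            rw [hmu2, hmu]
            field_simp
          rw [this]
          field_simp
  rw [← ofReal_mul ((c : ℝ) ^ (-5 / 2 : ℝ)), key]
  push_cast
  ring

end

section

open Complex Filter Topology MeasureTheory Finset

/-! ### The contribution of a Farey arc -/

/-- The coordinate `w` with `θ + i y = i / (k ^ 2 w)`. -/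
def cuspCoord (k : ℕ) (y θ : ℝ) : ℂ := (k ^ 2 * (y - θ * I))⁻¹

theorem cuspCoord_re (k : ℕ) (y θ : ℝ) :
    (cuspCoord k y θ).re = y / (k ^ 2 * (y ^ 2 + θ ^ 2)) := by
  have h : cuspCoord k y θ = (((k : ℝ) ^ 2)⁻¹ : ℝ) * (y - θ * I)⁻¹ := by
    rw [cuspCoord, mul_inv]
    push_cast
    rfl
  rw [h, re_ofReal_mul, inv_re, normSq_apply, div_eq_mul_inv y, mul_inv ((k : ℝ) ^ 2)]
  simp
  ring

theorem cuspCoord_im (k : ℕ) (y θ : ℝ) :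
    (cuspCoord k y θ).im = θ / (k ^ 2 * (y ^ 2 + θ ^ 2)) := by
  have h : cuspCoord k y θ = (((k : ℝ) ^ 2)⁻¹ : ℝ) * (y - θ * I)⁻¹ := by
    rw [cuspCoord, mul_inv]
    push_cast
    rfl
  rw [h, im_ofReal_mul, inv_im, normSq_apply, div_eq_mul_inv θ, mul_inv ((k : ℝ) ^ 2)]
  simp
  ring

theorem cuspCoord_re_pos {k : ℕ} (hk : 0 < k) {y : ℝ} (hy : 0 < y) (θ : ℝ) :
    0 < (cuspCoord k y θ).re := by
  rw [cuspCoord_re]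
  positivity

theorem cuspCoord_ne_zero {k : ℕ} (hk : 0 < k) {y : ℝ} (hy : 0 < y) (θ : ℝ) :
    cuspCoord k y θ ≠ 0 := fun h => by
  have := cuspCoord_re_pos hk hy θ
  simp [h] at this

theorem hasDerivAt_cuspCoord {k : ℕ} (hk : 0 < k) {y : ℝ} (hy : 0 < y) (θ : ℝ) :
    HasDerivAt (cuspCoord k y) (I * k ^ 2 * cuspCoord k y θ ^ 2) θ := by
  have h0 : (k ^ 2 * (y - θ * I) : ℂ) ≠ 0 := fun h =>
    cuspCoord_ne_zero hk hy θ (by rw [cuspCoord, h, inv_zero])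
  have h1 : HasDerivAt (fun θ : ℝ => (k ^ 2 * (y - θ * I) : ℂ)) (k ^ 2 * (-(1 * I))) θ :=
    ((((hasDerivAt_id θ).ofReal_comp).mul_const I).const_sub (y : ℂ)).const_mul _
  refine (h1.inv h0).congr_deriv ?_
  rw [cuspCoord]
  field_simp

theorem continuous_cuspCoord {k : ℕ} (hk : 0 < k) {y : ℝ} (hy : 0 < y) :
    Continuous (cuspCoord k y) :=
  continuous_iff_continuousAt.mpr fun θ => (hasDerivAt_cuspCoord hk hy θ).continuousAt

/-- The real parameter of the kernel that belongs to the cusps with denominator `k`. -/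
def cuspParam (n k : ℕ) : ℝ := 2 * Real.pi * (n - 1 / 24) / k ^ 2

theorem cuspParam_nonneg {n : ℕ} (hn : 1 ≤ n) (k : ℕ) : 0 ≤ cuspParam n k := by
  have : (1 : ℝ) ≤ n := by exact_mod_cast hn
  have h2 : (0 : ℝ) ≤ n - 1 / 24 := by linarith
  have := Real.pi_pos
  unfold cuspParam
  positivity

theorem cuspParam_le {n : ℕ} (hn : 1 ≤ n) {k : ℕ} (hk : 0 < k) :
    cuspParam n k ≤ 2 * Real.pi * n := by
  have hn' : (1 : ℝ) ≤ n := by exact_mod_cast hn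
  have hk' : (1 : ℝ) ≤ k := by exact_mod_cast hk
  have := Real.pi_pos
  unfold cuspParam
  have h2 : (0 : ℝ) ≤ n - 1 / 24 := by linarith
  refine (div_le_self (by positivity) (one_le_pow₀ hk')).trans ?_
  gcongr
  linarith

/-- The main term of `integrand` near the cusp `-d / k`. -/
def mainTerm (n k d : ℕ) (w : ℂ) : ℂ :=
  cuspCoeff n k d * ((k : ℂ) ^ (-1 / 2 : ℂ) * w ^ (-1 / 2 : ℂ) *
    exp (Real.pi / 12 * w + cuspParam n k / w))

/-- The factor i k² w² is dw/dθ. Splitting it off turns w^(-1/2) into the w^(-5/2) of the kernel and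
k^(-1/2) into k^(-5/2), and -i compensates i. -/
theorem mainTerm_eq (n : ℕ) {k : ℕ} (hk : 0 < k) (d : ℕ) {w : ℂ} (hw : w ≠ 0) :
    mainTerm n k d w = -I * cuspCoeff n k d * ((k : ℝ) ^ (-5 / 2 : ℝ) : ℝ) *
      (kernel (cuspParam n k) w * (I * k ^ 2 * w ^ 2)) := by
  have hk0 : (k : ℂ) ≠ 0 := by exact_mod_cast hk.ne'
  have h1 : w ^ (-1 / 2 : ℂ) = w ^ (-5 / 2 : ℂ) * w ^ 2 := by
    rw [← cpow_natCast w 2, ← cpow_add _ _ hw]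
    norm_num
  have h2 : (k : ℂ) ^ (-1 / 2 : ℂ) = (((k : ℝ) ^ (-5 / 2 : ℝ) : ℝ) : ℂ) * k ^ 2 := by
    rw [ofReal_cpow (by positivity), ← cpow_natCast (k : ℂ) 2]
    push_cast
    rw [← cpow_add _ _ hk0]
    norm_num
  rw [mainTerm, kernel, h1, h2]
  linear_combination ((cuspCoeff n k d * (((k : ℝ) ^ (-5 / 2 : ℝ) : ℝ) : ℂ) * k ^ 2 *
    (w ^ (-5 / 2 : ℂ) * w ^ 2) * exp (Real.pi / 12 * w + cuspParam n k / w))) * I_sq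

/-- At height y = 1/N² both y² and θ² are at most 1/(kN)², so Re w = y/(k²(y² + θ²)) ≥ 1/2. -/
theorem half_le_cuspCoord_re {N k : ℕ} (hk : 0 < k) (hkN : k ≤ N) {θ : ℝ}
    (hθ : |θ| ≤ 1 / (k * N)) : 1 / 2 ≤ (cuspCoord k (1 / N ^ 2) θ).re := by
  have hkR : (0 : ℝ) < k := by exact_mod_cast hk
  have hNR : (0 : ℝ) < N := by exact_mod_cast hk.trans_le hkN
  have hkN' : (k : ℝ) ≤ N := by exact_mod_cast hkN
  have h1 : θ ^ 2 ≤ 1 / (k * N) ^ 2 := by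
    rw [← sq_abs, ← one_div_pow]
    exact pow_le_pow_left₀ (abs_nonneg _) hθ 2
  have h2 : (1 / (N : ℝ) ^ 2) ^ 2 ≤ 1 / (k * N) ^ 2 := by
    rw [one_div_pow]
    refine one_div_le_one_div_of_le (by positivity) ?_
    rw [← pow_mul, mul_pow]
    calc (k : ℝ) ^ 2 * (N : ℝ) ^ 2 ≤ (N : ℝ) ^ 2 * (N : ℝ) ^ 2 := by gcongr
      _ = (N : ℝ) ^ (2 * 2) := by ring
  rw [cuspCoord_re, le_div_iff₀ (by positivity)]
  calc (1 / 2 : ℝ) * ((k : ℝ) ^ 2 * ((1 / (N : ℝ) ^ 2) ^ 2 + θ ^ 2))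
      ≤ 1 / 2 * ((k : ℝ) ^ 2 * (1 / (k * N) ^ 2 + 1 / (k * N) ^ 2)) := by gcongr
    _ = 1 / (N : ℝ) ^ 2 := by
      field_simp
      norm_num

theorem norm_cuspCoord_lower {N k : ℕ} (hk : 0 < k) (hkN : k ≤ N) {θ : ℝ}
    (hθ : |θ| ≤ 1 / (k * N)) : N / 2 ≤ k * ‖cuspCoord k (1 / N ^ 2) θ‖ := by
  have hkR : (0 : ℝ) < k := by exact_mod_cast hk
  have hNR : (0 : ℝ) < N := by exact_mod_cast hk.trans_le hkN
  have hkN' : (k : ℝ) ≤ N := by exact_mod_cast hkN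
  have hne : ((1 / N ^ 2 : ℝ) - θ * I : ℂ) ≠ 0 := fun h => by
    have := congrArg re h
    rw [sub_re, ofReal_re, re_ofReal_mul, I_re, mul_zero, sub_zero, zero_re] at this
    exact (by positivity : (1 / (N : ℝ) ^ 2) ≠ 0) this
  have h1 : ‖((1 / N ^ 2 : ℝ) - θ * I : ℂ)‖ ≤ 2 / (k * N) := by
    refine (norm_sub_le _ _).trans ?_
    rw [norm_mul, norm_I, mul_one, norm_real, norm_real, Real.norm_eq_abs, Real.norm_eq_abs,
      abs_of_pos (by positivity)]
    have : 1 / (N : ℝ) ^ 2 ≤ 1 / (k * N) :=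
      one_div_le_one_div_of_le (by positivity) (by nlinarith)
    calc _ ≤ 1 / (k * N : ℝ) + 1 / (k * N) := add_le_add this hθ
      _ = _ := by ring
  have h0 : 0 < ‖((1 / N ^ 2 : ℝ) - θ * I : ℂ)‖ := norm_pos_iff.mpr hne
  rw [cuspCoord, norm_inv, norm_mul, norm_pow, Complex.norm_natCast, mul_inv,
    show (k : ℝ) * (((k : ℝ) ^ 2)⁻¹ * ‖((1 / N ^ 2 : ℝ) - θ * I : ℂ)‖⁻¹)
      = 1 / (k * ‖((1 / N ^ 2 : ℝ) - θ * I : ℂ)‖) by field_simp, le_div_iff₀ (by positivity)]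
  calc (N : ℝ) / 2 * (k * ‖((1 / N ^ 2 : ℝ) - θ * I : ℂ)‖) ≤ N / 2 * (k * (2 / (k * N))) := by gcongr
    _ = 1 := by field_simp

/-- The error is the main term times P(q) - 1 = O(q). The decay |q| = e^(-2π Re w) outweighs e^(π Re
w/12), and β Re(1/w) = 2π(n - 1/24)/N² is bounded. The saving N^(-1/2) comes from (k|w|)^(-1/2). -/
theorem norm_integrand_sub_mainTerm_le {n : ℕ} (hn : 1 ≤ n) :
    ∃ C, 0 ≤ C ∧ ∀ N k d : ℕ, 0 < k → k ≤ N → Nat.Coprime k d → ∀ θ : ℝ, |θ| ≤ 1 / (k * N) →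
      ‖integrand n ((-(d : ℝ) / k + θ : ℝ) + (1 / N ^ 2 : ℝ) * I)
        - mainTerm n k d (cuspCoord k (1 / N ^ 2) θ)‖ ≤ C * (N : ℝ) ^ (-1 / 2 : ℝ) := by
  have hπ := Real.pi_pos
  obtain ⟨C, hC, hP⟩ := exists_norm_partGen_sub_one_le (Real.exp_pos (-Real.pi)).le
    (by simpa using hπ)
  refine ⟨C * Real.exp (2 * Real.pi * n) * (1 / 2 : ℝ) ^ (-1 / 2 : ℝ), by positivity,
    fun N k d hk hkN hcop θ hθ => ?_⟩
  have hkR : (0 : ℝ) < k := by exact_mod_cast hk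
  have hNR : (0 : ℝ) < N := by exact_mod_cast hk.trans_le hkN
  have hN1 : (1 : ℝ) ≤ N := by exact_mod_cast (hk.trans_le hkN)
  have hy : (0 : ℝ) < 1 / N ^ 2 := by positivity
  set w := cuspCoord k (1 / N ^ 2) θ with hw
  have hw0 : w ≠ 0 := cuspCoord_ne_zero hk hy θ
  have hre := half_le_cuspCoord_re hk hkN hθ
  have hnorm := norm_cuspCoord_lower hk hkN hθ
  rw [← hw] at hre hnorm
  have hkC : (k : ℂ) ≠ 0 := by exact_mod_cast hk.ne'
  have hτ : (((-(d : ℝ) / k + θ : ℝ) : ℂ) + (1 / N ^ 2 : ℝ) * I) = -d / k + I / (k ^ 2 * w) := by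
    have h1 : I / (k ^ 2 * w) = I * ((1 / N ^ 2 : ℝ) - θ * I) := by
      rw [hw, cuspCoord, mul_inv, ← mul_assoc, mul_inv_cancel₀ (pow_ne_zero 2 hkC), one_mul,
        div_inv_eq_mul]
    rw [h1]
    push_cast
    linear_combination (θ : ℂ) * I_sq
  have hint := integrand_cusp n hk hcop (w := w) (by linarith)
  have hparam : (2 * Real.pi * (n - 1 / 24) / k ^ 2 : ℂ) = (cuspParam n k : ℂ) := by
    rw [cuspParam]
    push_cast
    rfl
  rw [hparam, ← mainTerm] at hint
  rw [hτ, hint]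
  set q := exp (2 * Real.pi * I * ((matrixOfBottomRow k d 0 0 : ℂ) / k + I * w))
  have hq : ‖q‖ = Real.exp (-(2 * Real.pi * w.re)) := by
    rw [norm_exp_two_pi_I_mul]
    congr 3
    rw [add_im, I_mul_im,
      show ((matrixOfBottomRow k d 0 0 : ℂ) / k) = (((matrixOfBottomRow k d 0 0 : ℝ) / k : ℝ) : ℂ) by
        push_cast; rfl, ofReal_im, zero_add]
  have hq' : ‖q‖ ≤ Real.exp (-Real.pi) := by
    rw [hq, Real.exp_le_exp]
    nlinarith
  have hPq := hP q hq'
  have hpow : ‖(k : ℂ) ^ (-1 / 2 : ℂ) * w ^ (-1 / 2 : ℂ)‖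
      ≤ (1 / 2 : ℝ) ^ (-1 / 2 : ℝ) * (N : ℝ) ^ (-1 / 2 : ℝ) := by
    have e : (-1 / 2 : ℂ) = ((-1 / 2 : ℝ) : ℂ) := by push_cast; rfl
    rw [norm_mul, e, norm_cpow_real, norm_cpow_real, Complex.norm_natCast,
      ← Real.mul_rpow (by positivity) (by positivity),
      ← Real.mul_rpow (by positivity) (by positivity)]
    refine Real.rpow_le_rpow_of_nonpos (by positivity) ?_ (by norm_num)
    linarith
  have hexp : ‖exp (Real.pi / 12 * w + cuspParam n k / w)‖ * ‖q‖ ≤ Real.exp (2 * Real.pi * n) := by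
    have hre2 : (Real.pi / 12 * w + cuspParam n k / w : ℂ).re
        = Real.pi / 12 * w.re + cuspParam n k * (w⁻¹).re := by
      rw [div_eq_mul_inv (cuspParam n k : ℂ), add_re, re_ofReal_mul,
        show (Real.pi / 12 : ℂ) = ((Real.pi / 12 : ℝ) : ℂ) by push_cast; rfl, re_ofReal_mul]
    have hinv : (w⁻¹).re = k ^ 2 * (1 / N ^ 2) := by
      rw [hw, cuspCoord, inv_inv,
        show (k ^ 2 * ((1 / N ^ 2 : ℝ) - θ * I) : ℂ)
          = (((k : ℝ) ^ 2 : ℝ) : ℂ) * ((1 / N ^ 2 : ℝ) - θ * I) by push_cast; ring, re_ofReal_mul,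
        sub_re, ofReal_re, re_ofReal_mul, I_re, mul_zero, sub_zero]
    have hb : cuspParam n k * (w⁻¹).re ≤ 2 * Real.pi * n := by
      have hn' : (1 : ℝ) ≤ n := by exact_mod_cast hn
      rw [hinv, cuspParam]
      calc 2 * Real.pi * (n - 1 / 24) / k ^ 2 * (k ^ 2 * (1 / N ^ 2))
          = 2 * Real.pi * (n - 1 / 24) / N ^ 2 := by field_simp
        _ ≤ 2 * Real.pi * (n - 1 / 24) :=
          div_le_self (mul_nonneg (by positivity) (by linarith)) (one_le_pow₀ hN1)
        _ ≤ _ := by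
          gcongr
          linarith
    rw [norm_exp, hq, ← Real.exp_add, Real.exp_le_exp, hre2]
    nlinarith
  calc ‖mainTerm n k d w * partGen q - mainTerm n k d w‖
      = ‖(k : ℂ) ^ (-1 / 2 : ℂ) * w ^ (-1 / 2 : ℂ)‖ *
        (‖exp (Real.pi / 12 * w + cuspParam n k / w)‖ * ‖partGen q - 1‖) := by
        rw [← mul_sub_one, norm_mul, mainTerm, norm_mul, norm_cuspCoeff, one_mul, norm_mul, mul_assoc]
    _ ≤ ((1 / 2 : ℝ) ^ (-1 / 2 : ℝ) * (N : ℝ) ^ (-1 / 2 : ℝ)) *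
        (‖exp (Real.pi / 12 * w + cuspParam n k / w)‖ * (C * ‖q‖)) := by gcongr
    _ = ((1 / 2 : ℝ) ^ (-1 / 2 : ℝ) * (N : ℝ) ^ (-1 / 2 : ℝ)) *
        (C * (‖exp (Real.pi / 12 * w + cuspParam n k / w)‖ * ‖q‖)) := by ring
    _ ≤ ((1 / 2 : ℝ) ^ (-1 / 2 : ℝ) * (N : ℝ) ^ (-1 / 2 : ℝ)) *
        (C * Real.exp (2 * Real.pi * n)) := by gcongr
    _ = _ := by ring

theorem integral_mainTerm (n : ℕ) {k : ℕ} (hk : 0 < k) (d : ℕ) {y : ℝ} (hy : 0 < y) {Φ : ℂ → ℂ}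
    (hΦ : ∀ w, 0 < w.re → HasDerivAt Φ (kernel (cuspParam n k) w) w) (a b : ℝ) :
    IntervalIntegrable (fun θ => mainTerm n k d (cuspCoord k y θ)) volume a b ∧
    ∫ θ in a..b, mainTerm n k d (cuspCoord k y θ)
      = -I * cuspCoeff n k d * ((k : ℝ) ^ (-5 / 2 : ℝ) : ℝ) *
        (Φ (cuspCoord k y b) - Φ (cuspCoord k y a)) := by
  have hd : ∀ θ, HasDerivAt (fun θ => Φ (cuspCoord k y θ)) (kernel (cuspParam n k) (cuspCoord k y θ)
      * (I * k ^ 2 * cuspCoord k y θ ^ 2)) θ := fun θ =>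
    (hΦ _ (cuspCoord_re_pos hk hy θ)).comp θ (hasDerivAt_cuspCoord hk hy θ)
  have hc := continuous_cuspCoord hk hy
  have hcont : Continuous fun θ => kernel (cuspParam n k) (cuspCoord k y θ)
      * (I * k ^ 2 * cuspCoord k y θ ^ 2) :=
    ((differentiableOn_kernel _).continuousOn.comp_continuous hc fun θ =>
      cuspCoord_re_pos hk hy θ).mul (by fun_prop)
  simp only [fun θ => mainTerm_eq n hk d (cuspCoord_ne_zero hk hy θ)]
  refine ⟨(continuous_const.mul hcont).intervalIntegrable _ _, ?_⟩
  rw [intervalIntegral.integral_const_mul,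
    intervalIntegral.integral_eq_sub_of_hasDerivAt (fun θ _ => hd θ) (hcont.intervalIntegrable _ _)]

/-- Let m = k + l, so N ≤ m ≤ 2N, and θ = 1/(km), y = 1/N². Then Re w ≤ y/(k²θ²) = m²/N² ≤ 4. From y
≤ 2θ follows Im w ≥ 1/(5k²θ) = m/(5k). Changing the sign of θ conjugates w. -/
theorem cuspCoord_mediant {N k l : ℕ} (hk : 0 < k) (hkN : k ≤ N) (hl : l ∈ fareyDenoms N k) :
    ∃ u v : ℝ, 1 / 2 ≤ u ∧ u ≤ 4 ∧ N / (5 * k) ≤ v ∧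
      cuspCoord k (1 / N ^ 2) (1 / (k * (k + l))) = u + v * I ∧
      cuspCoord k (1 / N ^ 2) (-(1 / (k * (k + l)))) = u - v * I := by
  simp only [fareyDenoms, mem_filter, mem_Ioc] at hl
  obtain ⟨⟨hl1, hl2⟩, -⟩ := hl
  have hkR : (0 : ℝ) < k := by exact_mod_cast hk
  have hNR : (0 : ℝ) < N := by exact_mod_cast hk.trans_le hkN
  have hkN' : (k : ℝ) ≤ N := by exact_mod_cast hkN
  have hs1 : (N : ℝ) ≤ k + l := by
    have : N ≤ k + l := by omega
    exact_mod_cast this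
  have hs2 : (k + l : ℝ) ≤ 2 * N := by
    have : k + l ≤ 2 * N := by omega
    exact_mod_cast this
  set m : ℝ := k + l with hm
  have hm0 : 0 < m := by linarith
  set θ : ℝ := 1 / (k * m) with hθ
  have hθ0 : 0 < θ := by positivity
  have hθ1 : θ ≤ 1 / (k * N) := one_div_le_one_div_of_le (by positivity) (by gcongr)
  refine ⟨(cuspCoord k (1 / N ^ 2) θ).re, (cuspCoord k (1 / N ^ 2) θ).im,
    half_le_cuspCoord_re hk hkN (by rwa [abs_of_pos hθ0]), ?_, ?_, (re_add_im _).symm, ?_⟩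
  · rw [cuspCoord_re, div_le_iff₀ (by positivity)]
    have h1 : 1 / (N : ℝ) ^ 2 ≤ 4 * (k ^ 2 * θ ^ 2) := by
      rw [hθ, div_pow, mul_pow, one_pow, show 4 * ((k : ℝ) ^ 2 * (1 / (k ^ 2 * m ^ 2))) = 4 / m ^ 2 by
        field_simp, div_le_div_iff₀ (by positivity) (by positivity)]
      nlinarith
    have h2 : 0 ≤ 4 * ((k : ℝ) ^ 2 * (1 / N ^ 2) ^ 2) := by positivity
    linarith
  · have hy : 1 / (N : ℝ) ^ 2 ≤ 2 * θ := by
      rw [hθ, mul_one_div, div_le_div_iff₀ (by positivity) (by positivity)]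
      nlinarith
    have hy2 : (1 / (N : ℝ) ^ 2) ^ 2 ≤ (2 * θ) ^ 2 := pow_le_pow_left₀ (by positivity) hy 2
    rw [cuspCoord_im, div_le_div_iff₀ (by positivity) (by positivity)]
    calc (N : ℝ) * (k ^ 2 * ((1 / N ^ 2) ^ 2 + θ ^ 2)) ≤ N * (k ^ 2 * ((2 * θ) ^ 2 + θ ^ 2)) := by
          gcongr
      _ = θ * (5 * k) * (N * (k * θ)) := by ring
      _ ≤ θ * (5 * k) * 1 := by
          gcongr
          rw [hθ, show (N : ℝ) * (k * (1 / (k * m))) = N / m by field_simp]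
          exact (div_le_one hm0).mpr hs1
      _ = _ := by ring
  · apply Complex.ext
    · rw [sub_re, ofReal_re, re_ofReal_mul, I_re, mul_zero, sub_zero, cuspCoord_re, cuspCoord_re,
        neg_sq]
    · rw [sub_im, ofReal_im, im_ofReal_mul, I_im, mul_one, zero_sub, cuspCoord_im, cuspCoord_im,
        neg_sq, neg_div]

theorem rpow_tail_bound {N k : ℕ} (hk : 0 < k) (hN : 0 < N) {v : ℝ} (hv : N / (5 * k) ≤ v) :
    (k : ℝ) ^ (-5 / 2 : ℝ) * v ^ (-3 / 2 : ℝ)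
      ≤ (1 / 5 : ℝ) ^ (-3 / 2 : ℝ) * ((N : ℝ) ^ (-3 / 2 : ℝ) / k) := by
  have hkR : (0 : ℝ) < k := by exact_mod_cast hk
  have hNR : (0 : ℝ) < N := by exact_mod_cast hN
  have h1 : v ^ (-3 / 2 : ℝ) ≤ ((1 / 5) * (N / k) : ℝ) ^ (-3 / 2 : ℝ) := by
    refine Real.rpow_le_rpow_of_nonpos (by positivity) ?_ (by norm_num)
    refine le_trans (le_of_eq ?_) hv
    field_simp
  have h2 : (k : ℝ) ^ (-5 / 2 : ℝ) / (k : ℝ) ^ (-3 / 2 : ℝ) = 1 / k := by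
    rw [← Real.rpow_sub hkR, show (-5 / 2 - -3 / 2 : ℝ) = -1 by norm_num, Real.rpow_neg_one, one_div]
  calc (k : ℝ) ^ (-5 / 2 : ℝ) * v ^ (-3 / 2 : ℝ)
      ≤ (k : ℝ) ^ (-5 / 2 : ℝ) * ((1 / 5) * (N / k) : ℝ) ^ (-3 / 2 : ℝ) := by gcongr
    _ = (1 / 5 : ℝ) ^ (-3 / 2 : ℝ) * (N : ℝ) ^ (-3 / 2 : ℝ) *
        ((k : ℝ) ^ (-5 / 2 : ℝ) / (k : ℝ) ^ (-3 / 2 : ℝ)) := by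
        rw [Real.mul_rpow (by positivity) (by positivity), Real.div_rpow hNR.le hkR.le]
        ring
    _ = _ := by
        rw [h2]
        ring

/-- The integrals over the two parts of the Farey arcs around cusps with denominator `k`, up to
`O(N ^ (-3/2) / k)`. -/
theorem exists_arc_approx {n : ℕ} (hn : 1 ≤ n) :
    ∃ C, 0 ≤ C ∧ ∀ N k : ℕ, 0 < k → k ≤ N → ∃ R R' : ℂ, R + R' = lineIntegral (cuspParam n k) ∧
      ∀ l ∈ fareyDenoms N k,
        ‖rightArc (fun x => integrand n (x + (1 / N ^ 2 : ℝ) * I)) k l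
          - cuspCoeff n k (invRes k l) * ((k : ℝ) ^ (-5 / 2 : ℝ) : ℝ) * R‖
          ≤ C * ((N : ℝ) ^ (-3 / 2 : ℝ) / k) ∧
        ‖leftArc (fun x => integrand n (x + (1 / N ^ 2 : ℝ) * I)) k l
          - cuspCoeff n k (negInvRes k l) * ((k : ℝ) ^ (-5 / 2 : ℝ) : ℝ) * R'‖
          ≤ C * ((N : ℝ) ^ (-3 / 2 : ℝ) / k) := by
  obtain ⟨C₁, hC₁, happrox⟩ := norm_integrand_sub_mainTerm_le hn
  set C₂ := Real.exp (Real.pi / 3 + 2 * (2 * Real.pi * n))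
  have hC₂ : 0 < C₂ := Real.exp_pos _
  refine ⟨C₁ + C₂ * (1 / 5 : ℝ) ^ (-3 / 2 : ℝ), by positivity, fun N k hk hkN => ?_⟩
  obtain ⟨Φ, L, L', hΦ, hLL, hL, hL'⟩ :=
    exists_primitive_kernel (cuspParam_nonneg hn k) (cuspParam_le hn hk)
  have hN : 0 < N := hk.trans_le hkN
  have hkR : (0 : ℝ) < k := by exact_mod_cast hk
  have hNR : (0 : ℝ) < N := by exact_mod_cast hN
  have hy : (0 : ℝ) < 1 / N ^ 2 := by positivity
  set w₀ := cuspCoord k (1 / N ^ 2) 0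
  -- Pointwise error times length of the arc, with the main term integrated exactly by Φ.
  have hcmp : ∀ d : ℕ, Nat.Coprime k d → ∀ a b : ℝ, a ≤ b → -(1 / (k * N)) ≤ a → b ≤ 1 / (k * N) →
      ‖(∫ θ in a..b, integrand n ((-(d : ℝ) / k + θ : ℝ) + (1 / N ^ 2 : ℝ) * I))
        - -I * cuspCoeff n k d * ((k : ℝ) ^ (-5 / 2 : ℝ) : ℝ) *
          (Φ (cuspCoord k (1 / N ^ 2) b) - Φ (cuspCoord k (1 / N ^ 2) a))‖
        ≤ C₁ * (N : ℝ) ^ (-1 / 2 : ℝ) * (b - a) := fun d hd a b hab ha hb => by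
    obtain ⟨hi, he⟩ := integral_mainTerm n hk d hy hΦ a b
    have hi' : IntervalIntegrable (fun θ : ℝ =>
        integrand n ((-(d : ℝ) / k + θ : ℝ) + (1 / N ^ 2 : ℝ) * I)) volume a b :=
      ((continuous_integrand_line n hy).comp (by fun_prop :
        Continuous fun θ : ℝ => -(d : ℝ) / k + θ)).intervalIntegrable _ _
    rw [← he, ← intervalIntegral.integral_sub hi' hi]
    refine (intervalIntegral.norm_integral_le_of_norm_le_const fun θ hθ => ?_).trans
      (le_of_eq (by rw [abs_of_nonneg (sub_nonneg.mpr hab)]))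
    rw [Set.uIoc_of_le hab] at hθ
    exact happrox N k d hk hkN hd θ (abs_le.mpr ⟨by linarith [hθ.1], by linarith [hθ.2]⟩)
  have hlen : ∀ l ∈ fareyDenoms N k, (1 / (k * (k + l)) : ℝ) ≤ 1 / (k * N) := fun l hl => by
    simp only [fareyDenoms, mem_filter, mem_Ioc] at hl
    have h1 : N ≤ k + l := by omega
    have : (N : ℝ) ≤ k + l := by exact_mod_cast h1
    exact one_div_le_one_div_of_le (by positivity) (by gcongr)
  have hmain : ∀ t : ℝ, t ≤ 1 / (k * N) →
      C₁ * (N : ℝ) ^ (-1 / 2 : ℝ) * t ≤ C₁ * ((N : ℝ) ^ (-3 / 2 : ℝ) / k) := fun t ht => by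
    have e : (N : ℝ) ^ (-3 / 2 : ℝ) = (N : ℝ) ^ (-1 / 2 : ℝ) / N := by
      rw [show (-3 / 2 : ℝ) = -1 / 2 - 1 by norm_num, Real.rpow_sub_one hNR.ne']
    calc C₁ * (N : ℝ) ^ (-1 / 2 : ℝ) * t ≤ C₁ * (N : ℝ) ^ (-1 / 2 : ℝ) * (1 / (k * N)) := by gcongr
      _ = _ := by
        rw [e]
        field_simp
  have htail : ∀ (d : ℕ) (z : ℂ) (v : ℝ), N / (5 * k) ≤ v → ‖z‖ ≤ C₂ * v ^ (-3 / 2 : ℝ) →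
      ‖-I * cuspCoeff n k d * ((k : ℝ) ^ (-5 / 2 : ℝ) : ℝ) * z‖
        ≤ C₂ * (1 / 5 : ℝ) ^ (-3 / 2 : ℝ) * ((N : ℝ) ^ (-3 / 2 : ℝ) / k) := fun d z v hv hz => by
    rw [norm_mul, norm_mul, norm_mul, norm_neg, norm_I, norm_cuspCoeff, norm_real,
      Real.norm_of_nonneg (by positivity), one_mul, one_mul]
    calc (k : ℝ) ^ (-5 / 2 : ℝ) * ‖z‖ ≤ (k : ℝ) ^ (-5 / 2 : ℝ) * (C₂ * v ^ (-3 / 2 : ℝ)) := by gcongr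
      _ = C₂ * ((k : ℝ) ^ (-5 / 2 : ℝ) * v ^ (-3 / 2 : ℝ)) := by ring
      _ ≤ C₂ * ((1 / 5 : ℝ) ^ (-3 / 2 : ℝ) * ((N : ℝ) ^ (-3 / 2 : ℝ) / k)) :=
        mul_le_mul_of_nonneg_left (rpow_tail_bound hk hN hv) hC₂.le
      _ = _ := by ring
  -- The coordinate w₀ of the cusp's vertical (θ = 0) depends only on k and N, so the same R and R'
  -- serve every l, and Φ(w₀) cancels in their sum.
  refine ⟨-I * (L - Φ w₀), -I * (Φ w₀ - L'), ?_, fun l hl => ?_⟩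
  · calc -I * (L - Φ w₀) + -I * (Φ w₀ - L') = -I * (L - L') := by ring
      _ = _ := by
        rw [hLL, ← mul_assoc]
        simp
  obtain ⟨u, v, hu1, hu2, hv, hwr, hwl⟩ := cuspCoord_mediant hk hkN hl
  have hv0 : 0 < v := lt_of_lt_of_le (by positivity) hv
  have hθ0 : (0 : ℝ) ≤ 1 / (k * (k + l)) := by positivity
  have hcop : Nat.Coprime k l := (mem_filter.mp hl).2
  have hθ := hlen l hl
  constructor
  · have h1 := hcmp _ (coprime_invRes hk hcop) 0 _ hθ0 (by
      have : (0 : ℝ) ≤ 1 / (k * N) := by positivity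
      linarith) hθ
    have h2 := htail (invRes k l) _ v hv (hL u v hu1 hu2 hv0)
    rw [hwr, sub_zero] at h1
    rw [add_mul]
    refine le_trans ?_ (add_le_add (h1.trans (hmain _ hθ)) h2)
    refine le_trans (le_of_eq ?_) (norm_sub_le _ _)
    congr 1
    rw [rightArc]
    ring
  · have h1 := hcmp _ (coprime_negInvRes hk hcop) _ 0 (neg_nonpos.mpr hθ0) (neg_le_neg hθ)
      (by positivity)
    have h2 := htail (negInvRes k l) _ v hv (hL' u v hu1 hu2 hv0)
    rw [hwl, zero_sub, neg_neg] at h1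
    rw [add_mul]
    refine le_trans ?_ (add_le_add (h1.trans (hmain _ hθ)) h2)
    refine le_trans (le_of_eq ?_) (norm_add_le _ _)
    congr 1
    rw [leftArc]
    ring

/-! ### Rademacher's series -/

/-- The terms of Rademacher's series. -/
def seriesTerm (n k : ℕ) : ℂ :=
  A k n * ((k : ℝ) ^ (-5 / 2 : ℝ) : ℝ) * lineIntegral (cuspParam n k)

theorem exists_partial_sum_bound {n : ℕ} (hn : 1 ≤ n) :
    ∃ C, ∀ N : ℕ, 1 ≤ N →
      ‖(p n : ℂ) - ∑ k ∈ Icc 1 N, seriesTerm n k‖ ≤ C * (N : ℝ) ^ (-1 / 2 : ℝ) := by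
  obtain ⟨C, hC, happrox⟩ := exists_arc_approx hn
  refine ⟨2 * C, fun N hN => ?_⟩
  have hNR : (0 : ℝ) < N := by exact_mod_cast hN
  have hy : (0 : ℝ) < 1 / N ^ 2 := by positivity
  set f : ℝ → ℂ := fun x => integrand n (x + (1 / N ^ 2 : ℝ) * I) with hf
  have hper : Function.Periodic f 1 := fun x => by
    simp only [hf]
    rw [← integrand_add_one n (x + _)]
    congr 1
    push_cast
    ring
  rw [← integral_integrand n hy, integral_eq_sum_arcs hper (continuous_integrand_line n hy) hN,
    ← sum_sub_distrib]
  have hk : ∀ k ∈ Icc 1 N, ‖∑ l ∈ fareyDenoms N k, (rightArc f k l + leftArc f k l)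
      - seriesTerm n k‖ ≤ 2 * C * (N : ℝ) ^ (-3 / 2 : ℝ) := fun k hk => by
    rw [mem_Icc] at hk
    have hkR : (0 : ℝ) < k := by exact_mod_cast hk.1
    obtain ⟨R, R', hR, h⟩ := happrox N k hk.1 hk.2
    -- The right and left arcs with the same l generally belong to different cusps. No matching is
    -- needed: each family runs once over all reduced residues, so each coefficient sum is A_k(n),
    -- and R + R' is the full line integral.
    have hA : seriesTerm n k = ∑ l ∈ fareyDenoms N k,
        (cuspCoeff n k (invRes k l) * ((k : ℝ) ^ (-5 / 2 : ℝ) : ℝ) * R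
          + cuspCoeff n k (negInvRes k l) * ((k : ℝ) ^ (-5 / 2 : ℝ) : ℝ) * R') := by
      rw [sum_add_distrib, ← sum_mul, ← sum_mul, ← sum_mul, ← sum_mul,
        sum_fareyDenoms_invRes hk.1 hk.2 (cuspCoeff n k),
        sum_fareyDenoms_negInvRes hk.1 hk.2 (cuspCoeff n k), ← A_eq_sum_cuspCoeff, ← mul_add, hR,
        seriesTerm]
    rw [hA, ← sum_sub_distrib]
    refine (norm_sum_le_of_le (n := fun _ => 2 * (C * ((N : ℝ) ^ (-3 / 2 : ℝ) / k))) _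
      fun l hl => ?_).trans ?_
    · rw [add_sub_add_comm, two_mul]
      exact (norm_add_le _ _).trans (add_le_add (h l hl).1 (h l hl).2)
    · rw [sum_const, nsmul_eq_mul, card_fareyDenoms hk.2]
      have ht : (Nat.totient k : ℝ) ≤ k := by exact_mod_cast Nat.totient_le k
      calc (Nat.totient k : ℝ) * (2 * (C * ((N : ℝ) ^ (-3 / 2 : ℝ) / k)))
          ≤ k * (2 * (C * ((N : ℝ) ^ (-3 / 2 : ℝ) / k))) := by gcongr
        _ = _ := by field_simp
  refine (norm_sum_le_of_le _ hk).trans (le_of_eq ?_)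
  rw [sum_const, nsmul_eq_mul, Nat.card_Icc, Nat.add_sub_cancel,
    show (-3 / 2 : ℝ) = -1 / 2 - 1 by norm_num, Real.rpow_sub_one hNR.ne']
  field_simp

theorem seriesTerm_zero (n : ℕ) : seriesTerm n 0 = 0 := by
  simp [seriesTerm, A_eq_sum_cuspCoeff]

theorem summable_seriesTerm {n : ℕ} (hn : 1 ≤ n) : Summable (seriesTerm n) := by
  set C := Real.exp (Real.pi / 3 + 2 * (2 * Real.pi * n)) * Real.pi
  have hs : Summable fun k : ℕ => (k : ℝ) ^ (-3 / 2 : ℝ) * C :=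
    (Real.summable_nat_rpow.mpr (by norm_num)).mul_right C
  refine Summable.of_norm_bounded hs fun k => ?_
  rcases Nat.eq_zero_or_pos k with rfl | hk
  · rw [seriesTerm_zero, norm_zero]
    have := Real.pi_pos
    positivity
  have hkR : (0 : ℝ) < k := by exact_mod_cast hk
  rw [seriesTerm, norm_mul, norm_mul, norm_real, Real.norm_of_nonneg (by positivity)]
  have e : (k : ℝ) ^ (-3 / 2 : ℝ) = k * (k : ℝ) ^ (-5 / 2 : ℝ) := by
    rw [show (-3 / 2 : ℝ) = -5 / 2 + 1 by norm_num, Real.rpow_add_one hkR.ne', mul_comm]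
  rw [e]
  gcongr
  · exact norm_A_le k n
  · exact norm_lineIntegral_le (cuspParam_nonneg hn k) (cuspParam_le hn hk)

/-- The error bound identifies only the limit of the ordered partial sums; `summable_seriesTerm`
makes it the unconditional sum. -/
theorem hasSum_seriesTerm {n : ℕ} (hn : 1 ≤ n) : HasSum (seriesTerm n) (p n) := by
  obtain ⟨C, hC⟩ := exists_partial_sum_bound hn
  have h1 : Tendsto (fun N : ℕ => C * (N : ℝ) ^ (-1 / 2 : ℝ)) atTop (𝓝 0) := by
    have := ((tendsto_rpow_neg_atTop (show (0 : ℝ) < 1 / 2 by norm_num)).comp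
      tendsto_natCast_atTop_atTop).const_mul C
    simpa [neg_div, Function.comp_def] using this
  have h2 : Tendsto (fun N : ℕ => (p n : ℂ) - ∑ k ∈ Icc 1 N, seriesTerm n k) atTop (𝓝 0) :=
    squeeze_zero_norm' ((eventually_ge_atTop 1).mono hC) h1
  have h3 : Tendsto (fun N : ℕ => ∑ k ∈ Icc 1 N, seriesTerm n k) atTop (𝓝 (p n)) := by
    simpa using h2.const_sub (p n : ℂ)
  have h4 := (summable_seriesTerm hn).hasSum
  have h5 := (tendsto_add_atTop_iff_nat 1).mpr h4.tendsto_sum_nat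
  have h6 : ∀ N : ℕ, ∑ k ∈ range (N + 1), seriesTerm n k = ∑ k ∈ Icc 1 N, seriesTerm n k :=
    fun N => by
      rw [range_eq_Ico, sum_eq_sum_Ico_succ_bot (by omega), seriesTerm_zero, zero_add]
      rfl
  simp only [h6] at h5
  rwa [tendsto_nhds_unique h5 h3] at h4

theorem hasSum_seriesTerm_pnat {n : ℕ} (hn : 1 ≤ n) :
    HasSum (fun c : ℕ+ => seriesTerm n c) (p n) := by
  refine (PNat.coe_injective.hasSum_iff fun k hk => ?_).mpr (hasSum_seriesTerm hn)
  rcases Nat.eq_zero_or_pos k with rfl | h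
  · exact seriesTerm_zero n
  · exact absurd ⟨⟨k, h⟩, rfl⟩ hk

theorem seriesTerm_eq {n : ℕ} (hn : 1 ≤ n) {c : ℕ} (hc : 0 < c) :
    seriesTerm n c = (1 / (Real.pi * Real.sqrt 2) : ℂ) *
        (A c n * (Real.sqrt c : ℂ) *
          ((deriv (fun x : ℝ => Real.sinh (mu * Real.sqrt (x - 1 / 24) / c) /
            Real.sqrt (x - 1 / 24)) (n : ℝ) : ℝ) : ℂ)) := by
  have hn' : (1 : ℝ) ≤ n := by exact_mod_cast hn
  have h := lineIntegral_eq_deriv hc (x := n) (by linarith)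
  rw [seriesTerm, mul_assoc, cuspParam, h]
  ring

end

end Rademacher

end

theorem theorem1 (n : ℕ) (hn : 1 ≤ n) :
    HasSum
      (fun c : ℕ+ => (1 / (Real.pi * Real.sqrt 2) : ℂ) *
        (Rademacher.A c n * (Real.sqrt c : ℂ) *
          ((deriv (fun x : ℝ => Real.sinh (Rademacher.mu * Real.sqrt (x - 1 / 24) / c) /
            Real.sqrt (x - 1 / 24)) (n : ℝ) : ℝ) : ℂ)))
      (Rademacher.p n : ℂ) :=
  Rademacher.hasSum_of_forall_eq (fun c => Rademacher.seriesTerm_eq hn c.pos)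
    (Rademacher.hasSum_seriesTerm_pnat hn)
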